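/- **Language of sets with atoms.** Terms and predicates are given by $$s,t ::= a \mid \{s,t\} \mid \mathcal P(s) \mid \bigcup s \mid \{a\in t\mid\phi\} \mid \varnothing \mid \mathbb A, \qquad \phi ::= s=t \mid t\in s\mid \bot\mid \phi\wedge\phi\mid\phi\Rightarrow\phi\mid\forall a.\phi ,$$ where $a$ ranges over variables; the other connectives are the usual abbreviations. An *atom* is an element of $\mathbb A$; anything else is a *set*. Ordered pairs are $(x,y)=\{\{x,y\},\{x\}\}$; a *function-set* is a set of ordered pairs that is the graph of a function; $\mathbb N$ is the least set that contains $\varnothing$ and is closed under $a\mapsto a\cup\{a\}$. **ZFA** has the following axioms (universally closed; $\phi,\Phi$ range over all predicates): * AtmEmpty: $t\in s\Rightarrow s\notin\mathbb A$. * EmptySet: $\varnothing$ is a set and $t\notin\varnothing$. * Extensionality: $s,s'\notin\mathbb A\Rightarrow(\forall b(b\in s\Leftrightarrow b\in s'))\Rightarrow s=s'$. * Comprehension: $\{a\in t\mid\phi\}$ is a set, and $s\in\{a\in t\mid\phi\}\Leftrightarrow(s\in t\wedge\phi[a:=s])$ ($\phi$ may have parameters). * Pair: $t\in\{s,s'\}\Leftrightarrow(t=s\vee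 t=s')$. * Union: $\bigcup s$ is a set, and $t\in\bigcup s\Leftrightarrow\exists a(t\in a\wedge a\in s)$. * Powerset: $t\in\mathcal P(s)\Leftrightarrow t\subseteq s$, where $t\subseteq s$ means $\forall a(a\in t\Rightarrow a\in s)$. * Induction: $(\forall a((\forall b\in a.\,\phi[a:=b])\Rightarrow\phi))\Rightarrow\forall a\,\phi$, where $a$ is the only free variable of $\phi$. * Infinity: $\exists c(\varnothing\in c\wedge\forall a(a\in c\Rightarrow a\cup\{a\}\in c))$. * AtmInf: there is no injective function-set from $\mathbb A$ to $\mathbb N$. * Replacement: if $\Phi(x,y)$ (possibly with parameters) is functional, i.e. $\Phi(x,y)\wedge\Phi(x,y')\Rightarrow y=y'$, then $\exists b\forall a(a\in b\Leftrightarrow\exists a'(a'\in u\wedge\Phi(a',a)))$. **ZFAC** is ZFA plus Choice: for every $s$ there is a function-set $f$ whose domain consists of the subsets of $s$ that have an element, such that $f(y)\in y$ for all $y$ in its domain. **EZFAC** is ZFAC plus the axiom-scheme Equivar: for every predicate $\phi$ with free variables among $a_1,\dots,a_n$, for all $a_1,\dots,a_n$ and every permutation $\pi$ (a function-set that is a bijection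 $\mathbb A\to\mathbb A$), $\phi(a_1,\dots,a_n)\Leftrightarrow\phi(\pi\cdot a_1,\dots,\pi\cdot a_n)$. Here $\pi\cdot x$ is defined by $\in$-recursion: $\pi\cdot a=\pi(a)$ for atoms $a$ and $\pi\cdot X=\{\pi\cdot x\mid x\in X\}$ for sets $X$. A theory is *consistent* if it has a model. **Theorem.** 1. ZFAC is consistent relative to ZFC: if ZFC is consistent, then so is ZFAC. 2. EZFAC is consistent relative to ZFC: if ZFC is consistent, then so is EZFAC. Moreover this is witnessed inside models of ZFC by a class model: there are formulas $\delta(x)$, $\eta(x,y)$, $\alpha(x)$ of the language $\{\in\}$, without parameters, such that for every model $\mathfrak M$ of ZFC the class $\mathfrak N=\{x\in\mathfrak M\mid\mathfrak M\models\delta(x)\}$, with membership relation given by $\eta$ and with $\alpha$ defining the atoms, is a model of ZFAC and of EZFAC. -/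

import Mathlib

universe u

/-! ### Pure set theory: the language with one binary relation symbol, and the theory ZFC -/

namespace PureSets

open FirstOrder FirstOrder.Language

/-- The only symbol of the language of set theory is a binary relation symbol. -/
inductive Rel : ℕ → Type
  | mem : Rel 2

/-- The first-order language of set theory (equality is part of the logic). -/
def lang : FirstOrder.Language.{0, 0} := ⟨fun _ => Empty, Rel⟩

/-- The membership symbol. -/
abbrev memSym : lang.Relations 2 := Rel.mem

/-- Bounded formulas without free variables other than the `m` numbered ones `&0, …, &(m-1)`.
A quantifier in front of a formula in `m + 1` variables binds the variable `&m`. -/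
abbrev Fml (m : ℕ) : Type := lang.BoundedFormula Empty m

/-- The atomic formula `t ∈ s`. -/
def mem {m : ℕ} (t s : lang.Term (Empty ⊕ Fin m)) : Fml m :=
  Relations.boundedFormula₂ memSym t s

infix:88 " ∈' " => PureSets.mem

/-- The formula `φ` with its `i`-th variable replaced by the variable `&(σ i)`. -/
def inst {k m : ℕ} (φ : lang.Formula (Fin k)) (σ : Fin k → Fin m) : Fml m :=
  BoundedFormula.relabel (n := m) (k := 0) (fun i => Sum.inr (σ i)) φ

end PureSets

/-- Keep the first `n` variables (the parameters) and send the `i`-th of the `k` remaining ones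
to the variable `n + τ i`. -/
def keep {n k m : ℕ} (τ : Fin k → Fin m) : Fin (n + k) → Fin (n + m) :=
  Fin.addCases (Fin.castAdd m) (fun i => Fin.natAdd n (τ i))

namespace PureSets

open FirstOrder FirstOrder.Language

def extensionality : lang.Sentence :=
  ∀' ∀' ((∀' ((&2 ∈' &0) ⇔ (&2 ∈' &1))) ⟹ (&0 =' &1))

def foundation : lang.Sentence :=
  ∀' ((∃' (&1 ∈' &0)) ⟹ ∃' ((&1 ∈' &0) ⊓ ∀' ∼((&2 ∈' &0) ⊓ (&2 ∈' &1))))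

def pairing : lang.Sentence :=
  ∀' ∀' ∃' ∀' ((&3 ∈' &2) ⇔ ((&3 =' &0) ⊔ (&3 =' &1)))

def union : lang.Sentence :=
  ∀' ∃' ∀' ((&2 ∈' &1) ⇔ ∃' ((&3 ∈' &0) ⊓ (&2 ∈' &3)))

def powerset : lang.Sentence :=
  ∀' ∃' ∀' ((&2 ∈' &1) ⇔ ∀' ((&3 ∈' &2) ⟹ (&3 ∈' &0)))

/-- Some set contains the empty set, and `x ∪ {x}` whenever it contains `x`. -/
def infinity : lang.Sentence :=
  ∃' ((∃' ((&1 ∈' &0) ⊓ ∀' ∼(&2 ∈' &1))) ⊓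
    ∀' ((&1 ∈' &0) ⟹ ∃' ((&2 ∈' &0) ⊓ ∀' ((&3 ∈' &2) ⇔ ((&3 ∈' &1) ⊔ (&3 =' &1))))))

/-- Every set `s` of nonempty, pairwise disjoint sets has a set `c` that meets each member of `s`
in exactly one element. -/
def choice : lang.Sentence :=
  ∀' ((∀' ((&1 ∈' &0) ⟹ ∃' (&2 ∈' &1))) ⟹
    (∀' ∀' (((&1 ∈' &0) ⊓ (&2 ∈' &0)) ⟹ ((∃' ((&3 ∈' &1) ⊓ (&3 ∈' &2))) ⟹ (&1 =' &2)))) ⟹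
    ∃' ∀' ((&2 ∈' &0) ⟹
      ∃' (((&3 ∈' &2) ⊓ (&3 ∈' &1)) ⊓
        ∀' (((&4 ∈' &2) ⊓ (&4 ∈' &1)) ⟹ (&4 =' &3)))))

/-- For all parameters `p` and every set `a` there is the set of those `x ∈ a` with `φ(p, x)`. -/
def separation (n : ℕ) (φ : lang.Formula (Fin (n + 1))) : lang.Sentence :=
  BoundedFormula.alls (n := n)
    (∀' ∃' ∀' ((&(Fin.natAdd n (2 : Fin 3)) ∈' &(Fin.natAdd n (1 : Fin 3))) ⇔
      ((&(Fin.natAdd n (2 : Fin 3)) ∈' &(Fin.natAdd n (0 : Fin 3))) ⊓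
        inst (m := n + 3) φ (keep (m := 3) ![2]))))

/-- For all parameters `p` and every set `a`, if the relation `φ(p, x, y)` is functional in `x`
then there is the set of those `y` with `φ(p, x, y)` for some `x ∈ a`. -/
def replacement (n : ℕ) (φ : lang.Formula (Fin (n + 2))) : lang.Sentence :=
  BoundedFormula.alls (n := n)
    (∀' ((∀' ∀' ∀' ((inst (m := n + 4) φ (keep (m := 4) ![1, 2]) ⊓ inst (m := n + 4) φ (keep (m := 4) ![1, 3])) ⟹
          (&(Fin.natAdd n (2 : Fin 4)) =' &(Fin.natAdd n (3 : Fin 4))))) ⟹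
      ∃' ∀' ((&(Fin.natAdd n (2 : Fin 3)) ∈' &(Fin.natAdd n (1 : Fin 3))) ⇔
        ∃' ((&(Fin.natAdd n (3 : Fin 4)) ∈' &(Fin.natAdd n (0 : Fin 4))) ⊓
          inst (m := n + 4) φ (keep (m := 4) ![3, 2])))))

/-- Zermelo-Fraenkel set theory with choice. -/
def ZFC : lang.Theory :=
  {extensionality, foundation, pairing, union, powerset, infinity, choice} ∪
    {σ | ∃ n φ, σ = separation n φ} ∪ {σ | ∃ n φ, σ = replacement n φ}

end PureSets

/-! ### The language of sets with atoms, and its denotations -/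

namespace AtomSets

mutual
/-- Terms of the language of sets with atoms in the variables `0, …, n - 1`.
The term `compr t φ` is the bounded comprehension `{a ∈ t | φ}`; it binds the variable `a`, which
has the number `n` in `φ`. -/
inductive Tm : ℕ → Type
  | var {n : ℕ} : Fin n → Tm n
  | pair {n : ℕ} : Tm n → Tm n → Tm n
  | pow {n : ℕ} : Tm n → Tm n
  | sUnion {n : ℕ} : Tm n → Tm n
  | compr {n : ℕ} : Tm n → Fm (n + 1) → Tm n
  | empty {n : ℕ} : Tm n
  | atoms {n : ℕ} : Tm n
/-- Predicates of the language of sets with atoms in the variables `0, …, n - 1`; `mem t s` is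
`t ∈ s`, and the quantifier in `all φ` binds the variable number `n` of `φ`. -/
inductive Fm : ℕ → Type
  | eq {n : ℕ} : Tm n → Tm n → Fm n
  | mem {n : ℕ} : Tm n → Tm n → Fm n
  | bot {n : ℕ} : Fm n
  | and {n : ℕ} : Fm n → Fm n → Fm n
  | imp {n : ℕ} : Fm n → Fm n → Fm n
  | all {n : ℕ} : Fm (n + 1) → Fm n
end

/-- Extend a renaming of variables by the newly bound variable. -/
def liftRen {n m : ℕ} (σ : Fin n → Fin m) : Fin (n + 1) → Fin (m + 1) :=
  Fin.snoc (α := fun _ => Fin (m + 1)) (fun i => (σ i).castSucc) (Fin.last m)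

mutual
/-- Rename the free variables of a term. -/
def Tm.rename : {n m : ℕ} → (Fin n → Fin m) → Tm n → Tm m
  | _, _, σ, .var i => .var (σ i)
  | _, _, σ, .pair s t => .pair (s.rename σ) (t.rename σ)
  | _, _, σ, .pow s => .pow (s.rename σ)
  | _, _, σ, .sUnion s => .sUnion (s.rename σ)
  | _, _, σ, .compr t φ => .compr (t.rename σ) (φ.rename (liftRen σ))
  | _, _, _, .empty => .empty
  | _, _, _, .atoms => .atoms
/-- Rename the free variables of a predicate. -/
def Fm.rename : {n m : ℕ} → (Fin n → Fin m) → Fm n → Fm m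
  | _, _, σ, .eq s t => .eq (s.rename σ) (t.rename σ)
  | _, _, σ, .mem s t => .mem (s.rename σ) (t.rename σ)
  | _, _, _, .bot => .bot
  | _, _, σ, .and φ ψ => .and (φ.rename σ) (ψ.rename σ)
  | _, _, σ, .imp φ ψ => .imp (φ.rename σ) (ψ.rename σ)
  | _, _, σ, .all φ => .all (φ.rename (liftRen σ))
end

/-- A structure for the language of sets with atoms. The denotation of a comprehension term
`{a ∈ t | φ}` is `sep` applied to the denotation of `t` and the extension of `φ`. -/
structure Str (M : Type u) where
  mem : M → M → Prop
  pair : M → M → M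
  pow : M → M
  sUnion : M → M
  sep : M → Set M → M
  empty : M
  atoms : M

mutual
/-- The denotation of a term under a valuation of its variables. -/
def Str.eval {M : Type u} (S : Str M) : {n : ℕ} → Tm n → (Fin n → M) → M
  | _, .var i, v => v i
  | _, .pair s t, v => S.pair (S.eval s v) (S.eval t v)
  | _, .pow s, v => S.pow (S.eval s v)
  | _, .sUnion s, v => S.sUnion (S.eval s v)
  | _, .compr t φ, v =>
      S.sep (S.eval t v) {x | (S.sat φ (Fin.snoc (α := fun _ => M) v x)).down}
  | _, .empty, _ => S.empty
  | _, .atoms, _ => S.atoms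
/-- The truth value of a predicate under a valuation of its variables (lifted to the universe of
`M`, because the two functions are defined by simultaneous recursion). -/
def Str.sat {M : Type u} (S : Str M) : {n : ℕ} → Fm n → (Fin n → M) → ULift.{u} Prop
  | _, .eq s t, v => ⟨S.eval s v = S.eval t v⟩
  | _, .mem t s, v => ⟨S.mem (S.eval t v) (S.eval s v)⟩
  | _, .bot, _ => ⟨False⟩
  | _, .and φ ψ, v => ⟨(S.sat φ v).down ∧ (S.sat ψ v).down⟩
  | _, .imp φ ψ, v => ⟨(S.sat φ v).down → (S.sat ψ v).down⟩
  | _, .all φ, v => ⟨∀ x : M, (S.sat φ (Fin.snoc (α := fun _ => M) v x)).down⟩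
end

/-- Validity of a predicate under a valuation of its variables. -/
def Str.Sat {M : Type u} (S : Str M) {n : ℕ} (φ : Fm n) (v : Fin n → M) : Prop :=
  (S.sat φ v).down

/-! ### Syntactic sugar -/

prefix:max "§" => AtomSets.Tm.var
infix:70 " ≐ " => AtomSets.Fm.eq
infix:70 " ∊ " => AtomSets.Fm.mem
infixr:60 " ⋏ " => AtomSets.Fm.and
infixr:50 " ⇒ " => AtomSets.Fm.imp

def Fm.neg {n : ℕ} (φ : Fm n) : Fm n := φ ⇒ Fm.bot

def Fm.or {n : ℕ} (φ ψ : Fm n) : Fm n := (φ.neg ⋏ ψ.neg).neg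

def Fm.iff {n : ℕ} (φ ψ : Fm n) : Fm n := (φ ⇒ ψ) ⋏ (ψ ⇒ φ)

def Fm.ex {n : ℕ} (φ : Fm (n + 1)) : Fm n := (Fm.all φ.neg).neg

infix:45 " ⟺ " => AtomSets.Fm.iff

/-- `∃` over the last `k` variables. -/
def Fm.exs {n : ℕ} : (k : ℕ) → Fm (n + k) → Fm n
  | 0, φ => φ
  | k + 1, φ => Fm.exs k (Fm.ex φ)

/-- The universal closure. -/
def Fm.alls : {n : ℕ} → Fm n → Fm 0
  | 0, φ => φ
  | _ + 1, φ => (Fm.all φ).alls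

/-- The conjunction of `k` predicates. -/
def Fm.conj {n : ℕ} : {k : ℕ} → (Fin k → Fm n) → Fm n
  | 0, _ => Fm.bot.neg
  | _ + 1, f => f 0 ⋏ Fm.conj (fun i => f i.succ)

/-- `s` is not an atom, that is, `s` is a set. -/
def isSet {n : ℕ} (s : Tm n) : Fm n := (s ∊ Tm.atoms).neg

/-- The Kuratowski pair `(s, t) = {{s, t}, {s}}`. -/
def opair {n : ℕ} (s t : Tm n) : Tm n := Tm.pair (Tm.pair s t) (Tm.pair s s)

/-- `s ∪ {s}`. -/
def succ {n : ℕ} (s : Tm n) : Tm n := Tm.sUnion (Tm.pair s (Tm.pair s s))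

/-- Variable 0 contains `∅`, and `a ∪ {a}` whenever it contains `a`. -/
def inductiveSet : Fm 1 :=
  (Tm.empty ∊ §0) ⋏ Fm.all (§1 ∊ §0 ⇒ succ §1 ∊ §0)

/-- Variable 0 is a natural number: it lies in all inductive sets. -/
def isNat : Fm 1 := Fm.all (inductiveSet.rename ![1] ⇒ §0 ∊ §1)

/-- Variable 0 is a function-set: a set of ordered pairs that is single-valued. -/
def isFun : Fm 1 :=
  isSet §0 ⋏
  Fm.all (§1 ∊ §0 ⇒ Fm.ex (Fm.ex (§1 ≐ opair §2 §3))) ⋏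
  Fm.all (Fm.all (Fm.all (opair §1 §2 ∊ §0 ⇒ opair §1 §3 ∊ §0 ⇒ §2 ≐ §3)))

/-- The function-set in variable 0 is injective. -/
def isInj : Fm 1 :=
  Fm.all (Fm.all (Fm.all (opair §1 §3 ∊ §0 ⇒ opair §2 §3 ∊ §0 ⇒ §1 ≐ §2)))

/-- Variable 0 is an injective function-set from the atoms to the natural numbers. -/
def injAtomsNat : Fm 1 :=
  isFun ⋏ isInj ⋏
  Fm.all (Fm.all (opair §1 §2 ∊ §0 ⇒ (§1 ∊ Tm.atoms ⋏ isNat.rename ![2]))) ⋏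
  Fm.all (§1 ∊ Tm.atoms ⇒ Fm.ex (opair §1 §2 ∊ §0))

/-- Variable 1 is a choice function-set for variable 0: its domain consists of the nonempty
subsets of variable 0, and it maps each of them to one of its elements. -/
def isChoiceFun : Fm 2 :=
  isFun.rename ![1] ⋏
  Fm.all (Fm.all (opair §2 §3 ∊ §1 ⇒ (§2 ∊ Tm.pow §0 ⋏ §3 ∊ §2))) ⋏
  Fm.all (§2 ∊ Tm.pow §0 ⇒ Fm.ex (§3 ∊ §2) ⇒ Fm.ex (opair §2 §3 ∊ §1))

/-- Variable 0 is a permutation: a function-set that is a bijection on the atoms. -/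
def isPerm : Fm 1 :=
  isFun ⋏ isInj ⋏
  Fm.all (Fm.all (opair §1 §2 ∊ §0 ⇒ (§1 ∊ Tm.atoms ⋏ §2 ∊ Tm.atoms))) ⋏
  Fm.all (§1 ∊ Tm.atoms ⇒ Fm.ex (opair §1 §2 ∊ §0)) ⋏
  Fm.all (§1 ∊ Tm.atoms ⇒ Fm.ex (opair §2 §1 ∊ §0))

/-- Variable 2 is `π · x`, where `π` is variable 0 and `x` is variable 1. The pointwise action is
given by `π · a = π(a)` for an atom `a` and `π · X = {π · z | z ∈ X}` for a set `X`; accordingly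
there is a function-set (variable 3) that maps variable 1 to variable 2, whose domain contains the
elements of its elements, and which obeys these two equations on its domain. -/
def isAct : Fm 3 :=
  Fm.ex (isFun.rename ![3] ⋏ opair §1 §2 ∊ §3 ⋏
    Fm.all (Fm.all (opair §4 §5 ∊ §3 ⇒
      ((§4 ∊ Tm.atoms ⇒ opair §4 §5 ∊ §0) ⋏
       (isSet §4 ⇒
          (isSet §5 ⋏
           Fm.all (§6 ∊ §4 ⇒ Fm.ex (opair §6 §7 ∊ §3)) ⋏
           Fm.all (§6 ∊ §5 ⟺ Fm.ex (§7 ∊ §4 ⋏ opair §7 §6 ∊ §3))))))))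

/-! ### The axioms -/

/-- Atoms have no elements. -/
def atmEmpty : Fm 0 := Fm.all (Fm.all (§1 ∊ §0 ⇒ isSet §0))

/-- `∅` is a set and has no elements. -/
def emptySet : Fm 0 := isSet Tm.empty ⋏ Fm.all (§0 ∊ Tm.empty).neg

def extensionality : Fm 0 :=
  Fm.all (Fm.all (isSet §0 ⇒ isSet §1 ⇒ Fm.all (§2 ∊ §0 ⟺ §2 ∊ §1) ⇒ §0 ≐ §1))

/-- For all parameters and all `t`, `s`: `{a ∈ t | φ}` is a set, and
`s ∈ {a ∈ t | φ} ↔ s ∈ t ∧ φ[a := s]`. -/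
def comprehension (n : ℕ) (φ : Fm (n + 1)) : Fm 0 :=
  Fm.alls (n := n) (Fm.all (Fm.all
    (isSet (Tm.compr §(Fin.natAdd n (0 : Fin 2)) (φ.rename (keep (m := 3) ![2]))) ⋏
     (§(Fin.natAdd n (1 : Fin 2)) ∊
          Tm.compr §(Fin.natAdd n (0 : Fin 2)) (φ.rename (keep (m := 3) ![2])) ⟺
        (§(Fin.natAdd n (1 : Fin 2)) ∊ §(Fin.natAdd n (0 : Fin 2)) ⋏
          φ.rename (keep (m := 2) ![1]))))))

def pairing : Fm 0 :=
  Fm.all (Fm.all (Fm.all (§2 ∊ Tm.pair §0 §1 ⟺ Fm.or (§2 ≐ §0) (§2 ≐ §1))))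

def union : Fm 0 :=
  Fm.all (isSet (Tm.sUnion §0) ⋏
    Fm.all (§1 ∊ Tm.sUnion §0 ⟺ Fm.ex (§1 ∊ §2 ⋏ §2 ∊ §0)))

/-- `t ∈ 𝒫(s) ↔ t ⊆ s`. -/
def powerset : Fm 0 :=
  Fm.all (Fm.all (§1 ∊ Tm.pow §0 ⟺ Fm.all (§2 ∊ §1 ⇒ §2 ∊ §0)))

/-- `∈`-induction for a predicate `φ` whose only free variable is the induction variable. -/
def induction (φ : Fm 1) : Fm 0 :=
  Fm.all (Fm.all (§1 ∊ §0 ⇒ φ.rename ![1]) ⇒ φ) ⇒ Fm.all φ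

def infinity : Fm 0 := Fm.ex inductiveSet

/-- There is no injective function-set from the atoms to the natural numbers. -/
def atmInf : Fm 0 := (Fm.ex injAtomsNat).neg

/-- For all parameters `p` and every `u`, if the predicate `φ(p, x, y)` is functional in `x`,
then some `b` has as its elements exactly the `a` with `φ(p, a', a)` for some `a' ∈ u`. -/
def replacement (n : ℕ) (φ : Fm (n + 2)) : Fm 0 :=
  Fm.alls (n := n) (Fm.all
    (Fm.all (Fm.all (Fm.all
        (φ.rename (keep (m := 4) ![1, 2]) ⇒ φ.rename (keep (m := 4) ![1, 3]) ⇒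
          §(Fin.natAdd n (2 : Fin 4)) ≐ §(Fin.natAdd n (3 : Fin 4))))) ⇒
      Fm.ex (Fm.all
        (§(Fin.natAdd n (2 : Fin 3)) ∊ §(Fin.natAdd n (1 : Fin 3)) ⟺
          Fm.ex (§(Fin.natAdd n (3 : Fin 4)) ∊ §(Fin.natAdd n (0 : Fin 4)) ⋏
            φ.rename (keep (m := 4) ![3, 2]))))))

/-- Every `s` has a choice function-set. -/
def choice : Fm 0 := Fm.all (Fm.ex isChoiceFun)

/-- For all `a₁, …, aₙ` and every permutation `π`, the elements `bᵢ = π · aᵢ` exist and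
`φ(a₁, …, aₙ) ↔ φ(b₁, …, bₙ)`. The variables are `a₁, …, aₙ`, `π`, `b₁, …, bₙ`, in this order. -/
def equivar (n : ℕ) (φ : Fm n) : Fm 0 :=
  Fm.alls (n := n) (Fm.all (isPerm.rename ![Fin.last n] ⇒
    Fm.exs (n := n + 1) n
      (Fm.conj (fun i : Fin n => isAct.rename
          ![Fin.castAdd n (Fin.last n), Fin.castAdd n i.castSucc, Fin.natAdd (n + 1) i]) ⋏
        (φ.rename (fun i => Fin.castAdd n i.castSucc) ⟺
          φ.rename (fun i => Fin.natAdd (n + 1) i)))))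

/-- Zermelo-Fraenkel set theory with atoms. -/
def ZFA : Set (Fm 0) :=
  {atmEmpty, emptySet, extensionality, pairing, union, powerset, infinity, atmInf} ∪
    {σ | ∃ n φ, σ = comprehension n φ} ∪ {σ | ∃ φ, σ = induction φ} ∪
    {σ | ∃ n φ, σ = replacement n φ}

/-- ZFA with choice. -/
def ZFAC : Set (Fm 0) := ZFA ∪ {choice}

/-- ZFAC with the equivariance axiom-scheme. -/
def EZFAC : Set (Fm 0) := ZFAC ∪ {σ | ∃ n φ, σ = equivar n φ}

/-- The structure `S` is a model of the theory `T`. -/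
def Str.Models {M : Type u} (S : Str M) (T : Set (Fm 0)) : Prop :=
  ∀ σ ∈ T, S.Sat σ Fin.elim0

/-- A theory in the language of sets with atoms is consistent (satisfiable) if it has a model. -/
def Consistent (T : Set (Fm 0)) : Prop := ∃ (M : Type) (S : Str M), S.Models T

end AtomSets

-- Keep the domain of a model of ZFC (so the formula for the class is `⊤`) and change only its
-- membership relation. A set of natural numbers that contains 0 becomes an atom; a set of natural
-- numbers without 0 gets the predecessors of its elements as its new elements; every other set
-- keeps its elements. Thus each `X ⊆ ω` is coded by `{n + 1 | n ∈ X}`, each other set by itself,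
-- and decoding is a bijection from the non-atoms onto the old sets (`shift_ext`,
-- `exists_shiftMem_iff`). A class is a set in the new sense iff it is one in the old sense, which
-- carries over the set existence axioms and choice. A new element of `x` is an old element of `x`
-- or of an element of `x` (`shiftMem_cases`), so induction survives. The atoms correspond to the
-- subsets of ω, so Cantor's diagonal argument gives AtmInf (`shift_no_injection`).
--
-- Equivar needs nothing further. By ∈-recursion a permutation of the atoms extends to an
-- automorphism of the whole structure (`exists_automorphism`), and automorphisms preserve the truth
-- of all predicates (`Str.Iso.sat`). So the properties collected in `AtomUniverse.IsFull` yield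
-- ZFAC and EZFAC alike.
--
-- Replacement is available for definable relations only, so definability with parameters has to be
-- tracked throughout. `Dfn` and `DfnFun` are type classes in order that instance search builds the
-- defining formulas.

namespace PureSets

open FirstOrder FirstOrder.Language

-- Relations and functions definable with parameters.

section Definability

variable {M : Type u} [lang.Structure M]

/-- The relation `P` is first-order definable with parameters from `M`. -/
class Dfn {n : ℕ} (P : (Fin n → M) → Prop) : Prop where
  out : ∃ φ : lang.Formula (M ⊕ Fin n), ∀ v, P v ↔ φ.Realize (Sum.elim id v)

/-- The graph of `f` is first-order definable with parameters from `M`. -/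
class DfnFun {n : ℕ} (f : (Fin n → M) → M) : Prop where
  out : Dfn (fun w : Fin (n + 1) → M => w (Fin.last n) = f (fun i => w i.castSucc))

theorem Dfn.congr {n : ℕ} {P Q : (Fin n → M) → Prop} (h : Dfn P) (e : ∀ v, Q v ↔ P v) :
    Dfn Q := by
  obtain ⟨φ, hφ⟩ := h.out
  exact ⟨φ, fun v => (e v).trans (hφ v)⟩

/-- Substitution of variables and parameters for variables. -/
theorem Dfn.subst {n m : ℕ} {P : (Fin n → M) → Prop} (h : Dfn P) (τ : Fin n → M ⊕ Fin m) :
    Dfn (fun w : Fin m → M => P (fun i => Sum.elim id w (τ i))) := by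
  obtain ⟨φ, hφ⟩ := h.out
  refine ⟨φ.relabel (Sum.elim Sum.inl τ), fun v => ?_⟩
  rw [hφ, Formula.realize_relabel]
  apply iff_of_eq
  congr 1
  funext x
  rcases x with x | x <;> rfl

theorem Dfn.reindex {n m : ℕ} {P : (Fin n → M) → Prop} (h : Dfn P) (σ : Fin n → Fin m) :
    Dfn (fun w : Fin m → M => P (fun i => w (σ i))) :=
  h.subst fun i => Sum.inr (σ i)

instance Dfn.const {n : ℕ} (p : Prop) : Dfn (fun _ : Fin n → M => p) := by
  by_cases hp : p
  · exact ⟨⊤, fun v => by simp [hp]⟩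
  · exact ⟨⊥, fun v => by simp [hp, Formula.Realize]⟩

instance Dfn.not {n : ℕ} {P : (Fin n → M) → Prop} [h : Dfn P] : Dfn (fun v => ¬ P v) := by
  obtain ⟨φ, hφ⟩ := h.out
  exact ⟨φ.not, fun v => by rw [hφ, Formula.realize_not]⟩

instance Dfn.imp {n : ℕ} {P Q : (Fin n → M) → Prop} [h : Dfn P] [k : Dfn Q] :
    Dfn (fun v => P v → Q v) := by
  obtain ⟨φ, hφ⟩ := h.out
  obtain ⟨ψ, hψ⟩ := k.out
  exact ⟨φ.imp ψ, fun v => by rw [hφ, hψ, Formula.realize_imp]⟩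

instance Dfn.and {n : ℕ} {P Q : (Fin n → M) → Prop} [h : Dfn P] [k : Dfn Q] :
    Dfn (fun v => P v ∧ Q v) :=
  Dfn.congr (inferInstance : Dfn fun v => ¬ (P v → ¬ Q v)) fun v => by tauto

instance Dfn.or {n : ℕ} {P Q : (Fin n → M) → Prop} [h : Dfn P] [k : Dfn Q] :
    Dfn (fun v => P v ∨ Q v) :=
  Dfn.congr (inferInstance : Dfn fun v => ¬ P v → Q v) fun v => by tauto

instance Dfn.iff {n : ℕ} {P Q : (Fin n → M) → Prop} [h : Dfn P] [k : Dfn Q] :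
    Dfn (fun v => P v ↔ Q v) :=
  Dfn.congr (inferInstance : Dfn fun v => (P v → Q v) ∧ (Q v → P v)) fun v => by tauto

instance Dfn.all {n : ℕ} {P : (Fin n → M) → M → Prop}
    [h : Dfn (fun w : Fin (n + 1) → M => P (fun i => w i.castSucc) (w (Fin.last n)))] :
    Dfn (fun v => ∀ x, P v x) := by
  obtain ⟨φ, hφ⟩ := h.out
  -- The last free variable turns into the bound variable of the quantifier; parameters and the
  -- other variables stay free.
  let g : M ⊕ Fin (n + 1) → (M ⊕ Fin n) ⊕ Fin 1 :=
    Sum.elim (fun m => Sum.inl (Sum.inl m))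
      (Fin.lastCases (motive := fun _ => (M ⊕ Fin n) ⊕ Fin 1) (Sum.inr 0)
        fun j => Sum.inl (Sum.inr j))
  let ψ : lang.BoundedFormula (M ⊕ Fin n) 1 := BoundedFormula.relabel (n := 1) (k := 0) g φ
  refine ⟨ψ.all, fun v => ?_⟩
  unfold Formula.Realize
  rw [BoundedFormula.realize_all]
  refine forall_congr' fun x => ?_
  have := hφ (Fin.snoc (α := fun _ => M) v x)
  simp only [Fin.snoc_castSucc, Fin.snoc_last] at this
  rw [this]
  change _ ↔ (BoundedFormula.relabel (n := 1) (k := 0) g φ).Realize _ _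
  rw [BoundedFormula.realize_relabel]
  unfold Formula.Realize
  apply iff_of_eq
  congr 1
  · funext y
    rcases y with y | y
    · rfl
    · refine Fin.lastCases ?_ (fun j => ?_) y <;> simp [g, Fin.snoc]
  · exact Subsingleton.elim _ _

instance Dfn.ex {n : ℕ} {P : (Fin n → M) → M → Prop}
    [h : Dfn (fun w : Fin (n + 1) → M => P (fun i => w i.castSucc) (w (Fin.last n)))] :
    Dfn (fun v => ∃ x, P v x) :=
  Dfn.congr (inferInstance : Dfn fun v => ¬ ∀ x, ¬ P v x) fun v => by simp

theorem Dfn.eq_var {n : ℕ} (i j : Fin n) : Dfn (fun v : Fin n → M => v i = v j) :=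
  ⟨Term.equal (Term.var (Sum.inr i)) (Term.var (Sum.inr j)), fun v => by
    simp [Formula.realize_equal]⟩

theorem Dfn.eq_const {n : ℕ} (i : Fin n) (c : M) : Dfn (fun v : Fin n → M => v i = c) :=
  ⟨Term.equal (Term.var (Sum.inr i)) (Term.var (Sum.inl c)), fun v => by
    simp [Formula.realize_equal]⟩

instance DfnFun.var {n : ℕ} (i : Fin n) : DfnFun (fun v : Fin n → M => v i) :=
  ⟨Dfn.eq_var _ _⟩

instance DfnFun.const {n : ℕ} (c : M) : DfnFun (fun _ : Fin n → M => c) :=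
  ⟨Dfn.eq_const _ _⟩

/-- A definable function need not be the value of a term of the language, so it is substituted
through its graph, at the cost of a quantifier. -/
theorem Dfn.comp_last {n : ℕ} {R : (Fin n → M) → M → Prop}
    (hR : Dfn (fun w : Fin (n + 1) → M => R (fun i => w i.castSucc) (w (Fin.last n))))
    {f : (Fin n → M) → M} [hf : DfnFun f] : Dfn (fun v => R v (f v)) := by
  have := hf.out
  exact Dfn.congr (inferInstance : Dfn fun v => ∃ x, x = f v ∧ R v x) fun v => by simp

theorem Dfn.comp₁ {n : ℕ} {R : M → Prop} (hR : Dfn (fun v : Fin 1 → M => R (v 0)))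
    {f : (Fin n → M) → M} [hf : DfnFun f] : Dfn (fun v => R (f v)) :=
  Dfn.comp_last (R := fun _ x => R x) (hR.reindex fun _ => Fin.last n)

theorem DfnFun.lift {n : ℕ} {f : (Fin n → M) → M} (hf : DfnFun f) :
    DfnFun (fun w : Fin (n + 1) → M => f fun i => w i.castSucc) := by
  refine ⟨(hf.out.reindex
    (Fin.snoc (α := fun _ => Fin (n + 2)) (fun i => i.castSucc.castSucc) (Fin.last _))).congr
      fun v => ?_⟩
  simp

theorem Dfn.comp₂ {n : ℕ} {R : M → M → Prop} (hR : Dfn (fun v : Fin 2 → M => R (v 0) (v 1)))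
    {f g : (Fin n → M) → M} [hf : DfnFun f] [hg : DfnFun g] :
    Dfn (fun v => R (f v) (g v)) := by
  refine Dfn.comp_last (R := fun v x => R x (g v)) ?_ (f := f)
  have := hg.lift
  exact Dfn.comp_last (n := n + 1) (R := fun v x => R (v (Fin.last n)) x)
    (hR.reindex ![(Fin.last n).castSucc, Fin.last (n + 1)])
    (f := fun w : Fin (n + 1) → M => g fun i => w i.castSucc)

theorem Dfn.comp₃ {n : ℕ} {R : M → M → M → Prop}
    (hR : Dfn (fun v : Fin 3 → M => R (v 0) (v 1) (v 2)))
    {f g k : (Fin n → M) → M} [hf : DfnFun f] [hg : DfnFun g] [hk : DfnFun k] :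
    Dfn (fun v => R (f v) (g v) (k v)) := by
  refine Dfn.comp_last (R := fun v x => R x (g v) (k v)) ?_ (f := f)
  have := hg.lift
  have := hk.lift
  refine Dfn.comp_last (n := n + 1) (R := fun v x => R (v (Fin.last n)) x
    (k fun i => v i.castSucc)) ?_
    (f := fun w : Fin (n + 1) → M => g fun i => w i.castSucc)
  have := hk.lift.lift
  exact Dfn.comp_last (n := n + 2)
    (R := fun v x => R (v (Fin.last n).castSucc) (v (Fin.last (n + 1))) x)
    (hR.reindex ![(Fin.last n).castSucc.castSucc, (Fin.last (n + 1)).castSucc,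
      Fin.last (n + 2)])
    (f := fun w : Fin (n + 2) → M => k fun i => w i.castSucc.castSucc)

instance Dfn.eq {n : ℕ} {f g : (Fin n → M) → M} [DfnFun f] [DfnFun g] :
    Dfn (fun v => f v = g v) :=
  Dfn.comp₂ (Dfn.eq_var 0 1)

/-- A function is definable if its graph is given by a definable relation. -/
theorem DfnFun.of_graph {n : ℕ} {f : (Fin n → M) → M} (R : (Fin n → M) → M → Prop)
    (hR : Dfn (fun w : Fin (n + 1) → M => R (fun i => w i.castSucc) (w (Fin.last n))))
    (h : ∀ v x, x = f v ↔ R v x) : DfnFun f :=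
  ⟨hR.congr fun _ => h _ _⟩

theorem DfnFun.comp₁ {n : ℕ} {s : M → M} (hs : DfnFun (fun v : Fin 1 → M => s (v 0)))
    {f : (Fin n → M) → M} [hf : DfnFun f] : DfnFun (fun v => s (f v)) := by
  have := hf.lift
  exact ⟨Dfn.comp₂ (R := fun x y => x = s y) (hs.out.reindex ![1, 0])
    (f := fun w : Fin (n + 1) → M => w (Fin.last n))
    (g := fun w : Fin (n + 1) → M => f fun i => w i.castSucc)⟩

theorem DfnFun.comp₂ {n : ℕ} {s : M → M → M}
    (hs : DfnFun (fun v : Fin 2 → M => s (v 0) (v 1)))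
    {f g : (Fin n → M) → M} [hf : DfnFun f] [hg : DfnFun g] :
    DfnFun (fun v => s (f v) (g v)) := by
  have := hf.lift
  have := hg.lift
  exact ⟨Dfn.comp₃ (R := fun x y z => x = s y z) (hs.out.reindex ![1, 2, 0])
    (f := fun w : Fin (n + 1) → M => w (Fin.last n))
    (g := fun w : Fin (n + 1) → M => f fun i => w i.castSucc)
    (k := fun w : Fin (n + 1) → M => g fun i => w i.castSucc)⟩

/-- A definable relation is defined by a formula with finitely many parameters. -/
theorem Dfn.exists_params {m : ℕ} {P : (Fin m → M) → Prop} (h : Dfn P) :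
    ∃ (n : ℕ) (φ : lang.Formula (Fin (n + m))) (p : Fin n → M),
      ∀ v, P v ↔ φ.Realize (Fin.append p v) := by
  classical
  obtain ⟨φ, hφ⟩ := h.out
  -- Only the finitely many parameters that occur in `φ` matter; an enumeration of them gives the
  -- first variables of the new formula.
  let A : Finset M := φ.freeVarFinset.preimage Sum.inl Sum.inl_injective.injOn
  let e := A.equivFin
  let g : φ.freeVarFinset → Fin (A.card + m) := fun x =>
    match x with
    | ⟨Sum.inl a, ha⟩ => Fin.castAdd m (e ⟨a, by simpa [A] using ha⟩)
    | ⟨Sum.inr i, _⟩ => Fin.natAdd A.card i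
  refine ⟨A.card, φ.restrictFreeVar g, fun i => (e.symm i : M), fun v => ?_⟩
  rw [hφ]
  unfold Formula.Realize
  symm
  apply BoundedFormula.realize_restrictFreeVar
  rintro ⟨a | i, ha⟩ <;> simp [g]

end Definability

end PureSets
-- Universes with atoms and their operations.
namespace PureSets

open FirstOrder FirstOrder.Language

/-- A membership relation with atoms on a structure `M`, definable with parameters, that satisfies
extensionality, pairing, union, powerset and replacement, and whose atoms form a set. -/
structure AtomUniverse (M : Type u) [lang.Structure M] where
  mem : M → M → Prop
  atom : M → Prop
  dfn_mem : Dfn (fun v : Fin 2 → M => mem (v 0) (v 1))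
  dfn_atom : Dfn (fun v : Fin 1 → M => atom (v 0))
  not_atom_of_mem : ∀ {x y}, mem y x → ¬ atom x
  ext : ∀ {x y}, ¬ atom x → ¬ atom y → (∀ z, mem z x ↔ mem z y) → x = y
  exists_atoms : ∃ c, ¬ atom c ∧ ∀ z, mem z c ↔ atom z
  exists_pair : ∀ x y, ∃ c, ¬ atom c ∧ ∀ z, mem z c ↔ z = x ∨ z = y
  exists_sUnion : ∀ x, ∃ c, ¬ atom c ∧ ∀ z, mem z c ↔ ∃ y, mem y x ∧ mem z y
  exists_powerset : ∀ x, ∃ c, ¬ atom c ∧ ∀ z, mem z c ↔ ¬ atom z ∧ ∀ y, mem y z → mem y x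
  exists_image : ∀ (R : M → M → Prop), Dfn (fun v : Fin 2 → M => R (v 0) (v 1)) →
    (∀ x y y', R x y → R x y' → y = y') →
    ∀ u, ∃ c, ¬ atom c ∧ ∀ y, mem y c ↔ ∃ x, mem x u ∧ R x y

namespace AtomUniverse

variable {M : Type u} [lang.Structure M] (U : AtomUniverse M)

instance {n : ℕ} {f g : (Fin n → M) → M} [DfnFun f] [DfnFun g] :
    Dfn (fun v => U.mem (f v) (g v)) := U.dfn_mem.comp₂

instance {n : ℕ} {f : (Fin n → M) → M} [DfnFun f] : Dfn (fun v => U.atom (f v)) :=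
  U.dfn_atom.comp₁

/-- The class `C` is a set. -/
def Small (C : M → Prop) : Prop := ∃ c, ¬ U.atom c ∧ ∀ z, U.mem z c ↔ C z

/-- The set whose elements are the elements of the class `C`, if there is one. -/
noncomputable def cls (C : M → Prop) : M :=
  haveI : Nonempty M := ⟨U.exists_atoms.choose⟩
  Classical.epsilon fun c => ¬ U.atom c ∧ ∀ z, U.mem z c ↔ C z

variable {U}

theorem Small.spec {C : M → Prop} (h : U.Small C) :
    ¬ U.atom (U.cls C) ∧ ∀ z, U.mem z (U.cls C) ↔ C z :=
  Classical.epsilon_spec h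

theorem Small.congr {C D : M → Prop} (h : U.Small C) (e : ∀ z, D z ↔ C z) : U.Small D := by
  obtain ⟨c, hc, h⟩ := h
  exact ⟨c, hc, fun z => (h z).trans (e z).symm⟩

theorem Small.eq_cls_iff {C : M → Prop} (h : U.Small C) (x : M) :
    x = U.cls C ↔ ¬ U.atom x ∧ ∀ z, U.mem z x ↔ C z := by
  refine ⟨?_, fun hx => U.ext hx.1 h.spec.1 fun z => (hx.2 z).trans (h.spec.2 z).symm⟩
  rintro rfl
  exact h.spec

/-- `cls` is a choice by epsilon and has no formula of its own. When every `C v` is a set,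
extensionality makes it the unique non-atom with the right elements, and that description is
first-order. -/
theorem dfn_cls {n : ℕ} {C : (Fin n → M) → M → Prop} (hC : ∀ v, U.Small (C v))
    [Dfn (fun w : Fin (n + 1) → M => C (fun i => w i.castSucc) (w (Fin.last n)))] :
    DfnFun (fun v => U.cls (C v)) := by
  refine DfnFun.of_graph (fun v x => ¬ U.atom x ∧ ∀ z, U.mem z x ↔ C v z) ?_
    fun v x => (hC v).eq_cls_iff x
  have : Dfn (fun w : Fin (n + 1 + 1) → M =>
      C (fun i => w i.castSucc.castSucc) (w (Fin.last (n + 1)))) :=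
    (Dfn.reindex (P := fun w : Fin (n + 1) → M => C (fun i => w i.castSucc) (w (Fin.last n)))
      ‹_› (Fin.snoc (α := fun _ => Fin (n + 2)) (fun i => i.castSucc.castSucc) (Fin.last _))).congr
      fun v => by simp
  infer_instance

theorem Small.image {C : M → Prop} (hC : U.Small C) (R : M → M → Prop)
    [Dfn (fun v : Fin 2 → M => R (v 0) (v 1))] (hR : ∀ x y y', R x y → R x y' → y = y') :
    U.Small (fun y => ∃ x, C x ∧ R x y) := by
  obtain ⟨c, hc, h⟩ := hC
  obtain ⟨d, hd, k⟩ := U.exists_image R ‹_› hR c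
  exact ⟨d, hd, fun z => by simp only [k, h]⟩

/-- Separation is replacement along the partial identity on `D`: the relation must be functional but
not total. -/
theorem Small.sep {C : M → Prop} (hC : U.Small C) (D : M → Prop)
    [hD : Dfn (fun v : Fin 1 → M => D (v 0))] : U.Small (fun x => C x ∧ D x) := by
  have : Dfn (fun v : Fin 2 → M => D (v 0)) := hD.comp₁
  refine (hC.image (fun x y => x = y ∧ D x) ?_).congr ?_
  · rintro x y y' ⟨rfl, _⟩ ⟨rfl, _⟩; rfl
  · intro z
    constructor
    · exact fun h => ⟨z, h.1, rfl, h.2⟩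
    · rintro ⟨x, hx, rfl, h⟩; exact ⟨hx, h⟩

theorem Small.mono {C : M → Prop} (hC : U.Small C) (D : M → Prop)
    [hD : Dfn (fun v : Fin 1 → M => D (v 0))] (h : ∀ x, D x → C x) : U.Small D :=
  (hC.sep D).congr fun z => ⟨fun hz => ⟨h z hz, hz⟩, fun hz => hz.2⟩

theorem Small.biUnion {C : M → Prop} (hC : U.Small C) (R : M → M → Prop)
    [hR : Dfn (fun v : Fin 2 → M => R (v 0) (v 1))] (h : ∀ x, C x → U.Small (R x)) :
    U.Small (fun y => ∃ x, C x ∧ R x y) := by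
  have (n : ℕ) (i j : Fin n) : Dfn (fun v : Fin n → M => R (v i) (v j)) := hR.comp₂
  obtain ⟨b, hb, k⟩ := hC.image (fun x d => ¬ U.atom d ∧ ∀ z, U.mem z d ↔ R x z)
    fun x y y' h h' => U.ext h.1 h'.1 fun z => (h.2 z).trans (h'.2 z).symm
  obtain ⟨c, hc, l⟩ := U.exists_sUnion b
  refine ⟨c, hc, fun z => ?_⟩
  rw [l]
  constructor
  · rintro ⟨y, hy, hz⟩
    obtain ⟨x, hx, _, h⟩ := (k y).1 hy
    exact ⟨x, hx, (h z).1 hz⟩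
  · rintro ⟨x, hx, hz⟩
    obtain ⟨d, hd, e⟩ := h x hx
    exact ⟨d, (k d).2 ⟨x, hx, hd, e⟩, (e z).2 hz⟩

variable (U)

theorem small_atom : U.Small U.atom := U.exists_atoms

/-- This covers atoms too: the image of `x` under the identity is a non-atom with the same elements,
so it is empty if `x` is an atom. -/
theorem small_mem (x : M) : U.Small (fun z => U.mem z x) := by
  obtain ⟨c, hc, h⟩ := U.exists_image (fun y z => y = z) inferInstance
    (by rintro x y y' rfl rfl; rfl) x
  exact ⟨c, hc, fun z => by simp [h]⟩

theorem small_false : U.Small (fun _ => False) :=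
  U.small_atom.mono _ fun _ h => h.elim

theorem small_pair (x y : M) : U.Small (fun z => z = x ∨ z = y) := U.exists_pair x y

theorem small_sUnion (x : M) : U.Small (fun z => ∃ y, U.mem z y ∧ U.mem y x) :=
  Small.congr (U.exists_sUnion x) fun z => by simp only [and_comm]

variable {U} in
theorem Small.or {C D : M → Prop} (hC : U.Small C) (hD : U.Small D) :
    U.Small (fun x => C x ∨ D x) := by
  obtain ⟨c, hc, h⟩ := hC
  obtain ⟨d, hd, k⟩ := hD
  obtain ⟨p, hp, l⟩ := U.exists_pair c d
  exact Small.congr (U.exists_sUnion p) fun z => by simp [l, h, k]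

/-- Atoms have no elements and so are vacuously included in `x`. The powerset of the axiom therefore
consists of the subsets proper, which are non-atoms, together with all atoms. -/
theorem small_subset (x : M) : U.Small (fun z => ∀ y, U.mem y z → U.mem y x) := by
  refine Small.congr (Small.or (U.exists_powerset x) U.small_atom) fun z => ?_
  by_cases hz : U.atom z
  · simp only [hz, not_true, false_and, false_or, iff_true]
    exact fun y hy => (U.not_atom_of_mem hy hz).elim
  · simp [hz]

/-! ### The operations -/

noncomputable def pair (x y : M) : M := U.cls fun z => z = x ∨ z = y

noncomputable def pow (x : M) : M := U.cls fun z => ∀ y, U.mem y z → U.mem y x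

noncomputable def sUnion (x : M) : M := U.cls fun z => ∃ y, U.mem z y ∧ U.mem y x

noncomputable def empty : M := U.cls fun _ => False

noncomputable def atoms : M := U.cls U.atom

noncomputable def opair (x y : M) : M := U.pair (U.pair x y) (U.pair x x)

noncomputable def succ (x : M) : M := U.sUnion (U.pair x (U.pair x x))

@[simp] theorem mem_pair {x y z : M} : U.mem z (U.pair x y) ↔ z = x ∨ z = y :=
  (U.small_pair x y).spec.2 z

@[simp] theorem mem_pow {x z : M} : U.mem z (U.pow x) ↔ ∀ y, U.mem y z → U.mem y x :=
  (U.small_subset x).spec.2 z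

@[simp] theorem mem_sUnion {x z : M} : U.mem z (U.sUnion x) ↔ ∃ y, U.mem z y ∧ U.mem y x :=
  (U.small_sUnion x).spec.2 z

@[simp] theorem not_mem_empty {z : M} : ¬ U.mem z U.empty := U.small_false.spec.2 z |>.1

@[simp] theorem mem_atoms {z : M} : U.mem z U.atoms ↔ U.atom z := U.small_atom.spec.2 z

@[simp] theorem not_atom_pair {x y : M} : ¬ U.atom (U.pair x y) := (U.small_pair x y).spec.1

@[simp] theorem not_atom_sUnion {x : M} : ¬ U.atom (U.sUnion x) := (U.small_sUnion x).spec.1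

@[simp] theorem not_atom_empty : ¬ U.atom U.empty := U.small_false.spec.1

@[simp] theorem not_atom_opair {x y : M} : ¬ U.atom (U.opair x y) := U.not_atom_pair

@[simp] theorem mem_succ {x z : M} : U.mem z (U.succ x) ↔ U.mem z x ∨ z = x := by
  simp only [succ, mem_sUnion, mem_pair]
  constructor
  · rintro ⟨y, hz, rfl | rfl⟩
    · exact Or.inl hz
    · exact Or.inr (by simpa using hz)
  · rintro (hz | rfl)
    · exact ⟨x, hz, Or.inl rfl⟩
    · exact ⟨_, by simp, Or.inr rfl⟩

instance {n : ℕ} {f g : (Fin n → M) → M} [DfnFun f] [DfnFun g] :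
    DfnFun (fun v => U.pair (f v) (g v)) :=
  DfnFun.comp₂ (dfn_cls (C := fun (v : Fin 2 → M) z => z = v 0 ∨ z = v 1)
    fun v => U.small_pair (v 0) (v 1))

instance {n : ℕ} {f : (Fin n → M) → M} [DfnFun f] : DfnFun (fun v => U.pow (f v)) :=
  DfnFun.comp₁ (dfn_cls (C := fun (v : Fin 1 → M) z => ∀ y, U.mem y z → U.mem y (v 0))
    fun v => U.small_subset (v 0))

instance {n : ℕ} {f : (Fin n → M) → M} [DfnFun f] : DfnFun (fun v => U.sUnion (f v)) :=
  DfnFun.comp₁ (dfn_cls (C := fun (v : Fin 1 → M) z => ∃ y, U.mem z y ∧ U.mem y (v 0))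
    fun v => U.small_sUnion (v 0))

instance {n : ℕ} {f g : (Fin n → M) → M} [DfnFun f] [DfnFun g] :
    DfnFun (fun v => U.opair (f v) (g v)) :=
  inferInstanceAs (DfnFun fun v => U.pair (U.pair (f v) (g v)) (U.pair (f v) (f v)))

instance {n : ℕ} {f : (Fin n → M) → M} [DfnFun f] : DfnFun (fun v => U.succ (f v)) :=
  inferInstanceAs (DfnFun fun v => U.sUnion (U.pair (f v) (U.pair (f v) (f v))))

theorem pair_eq_pair {x y x' y' : M} :
    U.pair x y = U.pair x' y' ↔ (x = x' ∧ y = y') ∨ (x = y' ∧ y = x') := by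
  constructor
  · intro h
    have k : ∀ z, (z = x ∨ z = y) ↔ (z = x' ∨ z = y') := fun z => by
      rw [← U.mem_pair, h, U.mem_pair]
    have h1 := k x
    have h2 := k y
    have h3 := k x'
    have h4 := k y'
    grind
  · rintro (⟨rfl, rfl⟩ | ⟨rfl, rfl⟩)
    · rfl
    · exact U.ext (by simp) (by simp) fun z => by simp [or_comm]

@[simp] theorem opair_inj {x y x' y' : M} :
    U.opair x y = U.opair x' y' ↔ x = x' ∧ y = y' := by
  simp only [opair, pair_eq_pair]
  grind

/-! ### Natural numbers -/

def IsInductive (c : M) : Prop :=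
  U.mem U.empty c ∧ ∀ a, U.mem a c → U.mem (U.succ a) c

def IsNat (n : M) : Prop := ∀ c, U.IsInductive c → U.mem n c

instance {n : ℕ} {f : (Fin n → M) → M} [DfnFun f] : Dfn (fun v => U.IsInductive (f v)) :=
  Dfn.comp₁ (R := U.IsInductive) (inferInstanceAs (Dfn fun v : Fin 1 → M =>
    U.mem U.empty (v 0) ∧ ∀ a, U.mem a (v 0) → U.mem (U.succ a) (v 0)))

instance {n : ℕ} {f : (Fin n → M) → M} [DfnFun f] : Dfn (fun v => U.IsNat (f v)) :=
  Dfn.comp₁ (R := U.IsNat) (inferInstanceAs (Dfn fun v : Fin 1 → M =>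
    ∀ c, U.IsInductive c → U.mem (v 0) c))

variable {U} in
theorem IsNat.empty : U.IsNat U.empty := fun _ hc => hc.1

variable {U} in
theorem IsNat.succ {n : M} (h : U.IsNat n) : U.IsNat (U.succ n) :=
  fun c hc => hc.2 n (h c hc)

variable {U} in
theorem small_isNat (hinf : ∃ c, U.IsInductive c) : U.Small U.IsNat := by
  obtain ⟨c, hc⟩ := hinf
  exact (U.small_mem c).mono _ fun n hn => hn c hc

variable {U} in
-- Infinity makes the natural numbers with `P` a set, and this set is inductive.
theorem IsNat.induction (hinf : ∃ c, U.IsInductive c) (P : M → Prop)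
    [hP : Dfn (fun v : Fin 1 → M => P (v 0))] (h0 : P U.empty)
    (hs : ∀ n, U.IsNat n → P n → P (U.succ n)) {n : M} (hn : U.IsNat n) : P n := by
  obtain ⟨c, _, hc⟩ := (small_isNat hinf).sep P
  have : U.IsInductive c := by
    refine ⟨(hc _).2 ⟨IsNat.empty, h0⟩, fun a ha => ?_⟩
    rw [hc] at ha ⊢
    exact ⟨ha.1.succ, hs a ha.1 ha.2⟩
  exact ((hc n).1 (hn c this)).2

end AtomUniverse

end PureSets
-- Pure sets: recursion on the natural numbers, ∈-induction and choice.
namespace PureSets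

open FirstOrder FirstOrder.Language

/-- A universe without atoms that satisfies foundation, infinity and choice. -/
structure ZFCUniverse (M : Type u) [lang.Structure M] extends AtomUniverse M where
  not_atom : ∀ x, ¬ atom x
  foundation : ∀ x, (∃ y, mem y x) → ∃ y, mem y x ∧ ∀ z, ¬ (mem z x ∧ mem z y)
  infinity : ∃ c, toAtomUniverse.IsInductive c
  transversal : ∀ s, (∀ x, mem x s → ∃ y, mem y x) →
    (∀ x y, mem x s → mem y s → (∃ z, mem z x ∧ mem z y) → x = y) →
    ∃ c, ∀ x, mem x s → ∃ z, (mem z x ∧ mem z c) ∧ ∀ w, mem w x ∧ mem w c → w = z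

namespace ZFCUniverse

open AtomUniverse

variable {M : Type u} [lang.Structure M] (V : ZFCUniverse M)

theorem eq_of_mem_iff {x y : M} (h : ∀ z, V.mem z x ↔ V.mem z y) : x = y :=
  V.ext (V.not_atom x) (V.not_atom y) h

theorem mem_asymm {a b : M} (hab : V.mem a b) (hba : V.mem b a) : False := by
  obtain ⟨y, hy, h⟩ := V.foundation (V.pair a b) ⟨a, by simp⟩
  rcases V.mem_pair.1 hy with rfl | rfl
  · exact h b ⟨by simp, hba⟩
  · exact h a ⟨by simp, hab⟩

/-- If `a` and `b` differed, each would be an element of the other, against foundation. -/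
theorem succ_inj {a b : M} (h : V.succ a = V.succ b) : a = b := by
  have h1 : V.mem a (V.succ b) := h ▸ V.mem_succ.2 (Or.inr rfl)
  have h2 : V.mem b (V.succ a) := h ▸ V.mem_succ.2 (Or.inr rfl)
  rw [mem_succ] at h1 h2
  rcases h1 with h1 | h1
  · rcases h2 with h2 | h2
    · exact (V.mem_asymm h1 h2).elim
    · exact h2.symm
  · exact h1

theorem succ_ne_empty (a : M) : V.succ a ≠ V.empty := fun h =>
  V.not_mem_empty (h ▸ V.mem_succ.2 (Or.inr rfl) : V.mem a V.empty)

theorem isNat_cases {n : M} (hn : V.IsNat n) : n = V.empty ∨ ∃ k, V.IsNat k ∧ n = V.succ k :=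
  IsNat.induction V.infinity (fun n => n = V.empty ∨ ∃ k, V.IsNat k ∧ n = V.succ k)
    (Or.inl rfl) (fun n hn _ => Or.inr ⟨n, hn, rfl⟩) hn

/-! ### Recursion on the natural numbers -/

/-- Every element of `g` is a pair `(0, c)`, or a pair `(k + 1, s z)` with `(k, z)` in `g`. -/
def IsDerivation (c : M) (s : M → M) (g : M) : Prop :=
  ∀ p, V.mem p g → p = V.opair V.empty c ∨
    ∃ k z, V.mem (V.opair k z) g ∧ p = V.opair (V.succ k) (s z)

/-- The value at `n` of the function with `h 0 = c` and `h (k + 1) = s (h k)` is `y`. -/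
def RecVal (c : M) (s : M → M) (n y : M) : Prop :=
  V.IsNat n ∧ ∃ g, V.mem (V.opair n y) g ∧ V.IsDerivation c s g

section Recursion

variable {V} (c : M) (s : M → M)

theorem dfn_recVal [hs : DfnFun (fun v : Fin 1 → M => s (v 0))] :
    Dfn (fun v : Fin 2 → M => V.RecVal c s (v 0) (v 1)) := by
  have (n : ℕ) (f : (Fin n → M) → M) [DfnFun f] : DfnFun (fun v => s (f v)) := hs.comp₁
  unfold RecVal IsDerivation
  infer_instance

theorem recVal_empty : V.RecVal c s V.empty c := by
  refine ⟨IsNat.empty, V.pair (V.opair V.empty c) (V.opair V.empty c), by simp, fun p hp => ?_⟩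
  left
  simpa using hp

variable {c s}

theorem RecVal.succ {n y : M} (h : V.RecVal c s n y) : V.RecVal c s (V.succ n) (s y) := by
  obtain ⟨hn, g, hg, hd⟩ := h
  let q := V.opair (V.succ n) (s y)
  refine ⟨hn.succ, V.sUnion (V.pair g (V.pair q q)), ?_, fun p hp => ?_⟩
  · rw [mem_sUnion]
    exact ⟨V.pair q q, by simp [q], by simp⟩
  · have mono : ∀ p, V.mem p g → V.mem p (V.sUnion (V.pair g (V.pair q q))) := fun p hp =>
      V.mem_sUnion.2 ⟨g, hp, by simp⟩
    obtain ⟨w, hpw, hw⟩ := V.mem_sUnion.1 hp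
    rcases V.mem_pair.1 hw with rfl | rfl
    · rcases hd p hpw with h | ⟨k, z, hk, rfl⟩
      · exact Or.inl h
      · exact Or.inr ⟨k, z, mono _ hk, rfl⟩
    · right
      exact ⟨n, y, mono _ hg, by simpa using hpw⟩

theorem RecVal.eq_of_empty {y : M} (h : V.RecVal c s V.empty y) : y = c := by
  obtain ⟨_, g, hg, hd⟩ := h
  rcases hd _ hg with h | ⟨k, z, _, h⟩
  · exact (V.opair_inj.1 h).2
  · exact (V.succ_ne_empty k (V.opair_inj.1 h).1.symm).elim

theorem RecVal.eq_of_succ {n y : M} (hn : V.IsNat n) (h : V.RecVal c s (V.succ n) y) :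
    ∃ z, V.RecVal c s n z ∧ y = s z := by
  obtain ⟨_, g, hg, hd⟩ := h
  rcases hd _ hg with h | ⟨k, z, hk, h⟩
  · exact (V.succ_ne_empty n (V.opair_inj.1 h).1).elim
  · obtain ⟨h1, h2⟩ := V.opair_inj.1 h
    obtain rfl := V.succ_inj h1
    exact ⟨z, ⟨hn, g, hk, hd⟩, h2⟩

/-- A derivation need not be single-valued, so uniqueness is proved by induction on `n`, inverting
the last step of a derivation. -/
theorem existsUnique_recVal [hs : DfnFun (fun v : Fin 1 → M => s (v 0))] {n : M}
    (hn : V.IsNat n) : ∃! y, V.RecVal c s n y := by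
  have (n : ℕ) (f g : (Fin n → M) → M) [DfnFun f] [DfnFun g] :
    Dfn (fun v => V.RecVal c s (f v) (g v)) := (dfn_recVal c s).comp₂
  refine IsNat.induction V.infinity
    (fun n => ∃ y, V.RecVal c s n y ∧ ∀ z, V.RecVal c s n z → z = y) ?_ ?_ hn
  · exact ⟨c, recVal_empty c s, fun z hz => hz.eq_of_empty⟩
  · rintro n hn ⟨y, hy, h⟩
    refine ⟨s y, hy.succ, fun z hz => ?_⟩
    obtain ⟨w, hw, rfl⟩ := hz.eq_of_succ hn
    rw [h w hw]

theorem RecVal.unique [hs : DfnFun (fun v : Fin 1 → M => s (v 0))] {n y z : M}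
    (hy : V.RecVal c s n y) (hz : V.RecVal c s n z) : y = z :=
  (existsUnique_recVal hy.1).unique hy hz

/-- The range of the function with `h 0 = c` and `h (k + 1) = s (h k)` is a set. -/
theorem small_range_recVal (c : M) (s : M → M) [hs : DfnFun (fun v : Fin 1 → M => s (v 0))] :
    V.Small (fun y => ∃ n, V.RecVal c s n y) := by
  have := dfn_recVal (V := V) c s
  exact ((small_isNat V.infinity).image (V.RecVal c s) fun _ _ _ h h' => h.unique h').congr
    fun z => ⟨fun ⟨n, h⟩ => ⟨n, h.1, h⟩, fun ⟨n, _, h⟩ => ⟨n, h⟩⟩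

end Recursion

/-- Every `x` is an element of a transitive set. -/
theorem exists_transitive (x : M) :
    ∃ T, V.mem x T ∧ ∀ y z, V.mem y T → V.mem z y → V.mem z T := by
  let c := V.pair x x
  -- The transitive closure: the union of `{x}`, `⋃ {x}`, `⋃ ⋃ {x}` and so on.
  obtain ⟨b, _, hb⟩ := small_range_recVal (V := V) c V.sUnion
  refine ⟨V.sUnion b, V.mem_sUnion.2 ⟨c, by simp [c], (hb c).2 ⟨_, recVal_empty _ _⟩⟩, ?_⟩
  intro y z hy hz
  obtain ⟨w, hyw, hw⟩ := V.mem_sUnion.1 hy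
  obtain ⟨n, hn⟩ := (hb w).1 hw
  exact V.mem_sUnion.2 ⟨V.sUnion w, V.mem_sUnion.2 ⟨y, hz, hyw⟩, (hb _).2 ⟨_, hn.succ⟩⟩

/-- Foundation speaks of sets only. The counterexamples inside a transitive set around `x` form a
set, and a minimal one among them contradicts `h`. -/
theorem mem_induction (P : M → Prop) [hP : Dfn (fun v : Fin 1 → M => P (v 0))]
    (h : ∀ x, (∀ y, V.mem y x → P y) → P x) (x : M) : P x := by
  by_contra hx
  obtain ⟨T, hxT, hT⟩ := V.exists_transitive x
  obtain ⟨b, _, hb⟩ := (V.small_mem T).sep fun z => ¬ P z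
  obtain ⟨m, hm, hmin⟩ := V.foundation b ⟨x, (hb x).2 ⟨hxT, hx⟩⟩
  obtain ⟨hmT, hPm⟩ := (hb m).1 hm
  refine hPm (h m fun y hy => ?_)
  by_contra hPy
  exact hmin y ⟨(hb y).2 ⟨hT m y hmT hy, hPy⟩, hy⟩

/-- Sets indexed by the elements of a set admit a simultaneous definable choice of elements. -/
theorem exists_choice {C : M → Prop} (hC : V.Small C) (R : M → M → Prop)
    [hR : Dfn (fun v : Fin 2 → M => R (v 0) (v 1))] (hs : ∀ t, C t → V.Small (R t))
    (hne : ∀ t, C t → ∃ y, R t y) :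
    ∃ Q : M → M → Prop, Dfn (fun v : Fin 2 → M => Q (v 0) (v 1)) ∧
      ∀ t, C t → ∃! y, R t y ∧ Q t y := by
  have (n : ℕ) (f g : (Fin n → M) → M) [DfnFun f] [DfnFun g] :
    Dfn (fun v => R (f v) (g v)) := hR.comp₂
  -- Tagging the elements of a fibre with their index `t` makes the fibres disjoint, as the
  -- transversal form of choice requires.
  have hfib (t : M) (ht : C t) : V.Small fun p => ∃ y, R t y ∧ p = V.opair t y :=
    (hs t ht).image (fun y p => p = V.opair t y) (by rintro _ _ _ rfl rfl; rfl)
  obtain ⟨s, _, hs⟩ := hC.image (fun t w => ∀ p, V.mem p w ↔ ∃ y, R t y ∧ p = V.opair t y)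
    fun t w w' h h' => V.eq_of_mem_iff fun z => (h z).trans (h' z).symm
  have nonempty : ∀ w, V.mem w s → ∃ p, V.mem p w := by
    intro w hw
    obtain ⟨t, ht, h⟩ := (hs w).1 hw
    obtain ⟨y, hy⟩ := hne t ht
    exact ⟨_, (h _).2 ⟨y, hy, rfl⟩⟩
  have disjoint : ∀ w w', V.mem w s → V.mem w' s → (∃ p, V.mem p w ∧ V.mem p w') → w = w' := by
    rintro w w' hw hw' ⟨p, hp, hp'⟩
    obtain ⟨t, ht, h⟩ := (hs w).1 hw
    obtain ⟨t', ht', h'⟩ := (hs w').1 hw'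
    obtain ⟨y, hy, rfl⟩ := (h p).1 hp
    obtain ⟨y', hy', e⟩ := (h' _).1 hp'
    obtain ⟨rfl, _⟩ := V.opair_inj.1 e
    exact V.eq_of_mem_iff fun z => (h z).trans (h' z).symm
  obtain ⟨c, hc⟩ := V.transversal s nonempty disjoint
  -- The transversal may have elements outside the fibres, so `Q` alone need not be single-valued;
  -- only its conjunction with `R` is.
  refine ⟨fun t y => V.mem (V.opair t y) c, inferInstance, fun t ht => ?_⟩
  obtain ⟨w, _, hw⟩ := hfib t ht
  obtain ⟨z, ⟨hzw, hzc⟩, huniq⟩ := hc w ((hs w).2 ⟨t, ht, hw⟩)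
  obtain ⟨y, hy, rfl⟩ := (hw z).1 hzw
  refine ⟨y, ⟨hy, hzc⟩, fun y' hy' => ?_⟩
  exact (V.opair_inj.1 (huniq _ ⟨(hw _).2 ⟨y', hy'.1, rfl⟩, hy'.2⟩)).2

end ZFCUniverse

end PureSets
-- The shifted universe: sets of natural numbers recoded to make room for atoms.
namespace PureSets

open FirstOrder FirstOrder.Language

/-- The universe `U` satisfies infinity, choice, and induction, every element lies in a transitive
set, and there is no definable injection from the atoms to the natural numbers. -/
structure AtomUniverse.IsFull {M : Type u} [lang.Structure M] (U : AtomUniverse M) : Prop where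
  infinity : ∃ c, U.IsInductive c
  exists_transitive : ∀ x, ∃ T, U.mem x T ∧ ∀ y z, U.mem y T → U.mem z y → U.mem z T
  induction : ∀ P : M → Prop, Dfn (fun v : Fin 1 → M => P (v 0)) →
    (∀ x, (∀ y, U.mem y x → P y) → P x) → ∀ x, P x
  choice : ∀ (C : M → Prop) (R : M → M → Prop), U.Small C →
    Dfn (fun v : Fin 2 → M => R (v 0) (v 1)) → (∀ t, C t → U.Small (R t)) →
    (∀ t, C t → ∃ y, R t y) →
    ∃ Q : M → M → Prop, Dfn (fun v : Fin 2 → M => Q (v 0) (v 1)) ∧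
      ∀ t, C t → ∃! y, R t y ∧ Q t y
  no_injection : ∀ Q : M → M → Prop, Dfn (fun v : Fin 2 → M => Q (v 0) (v 1)) →
    (∀ a, U.atom a → ∃ n, U.IsNat n ∧ Q a n) → (∀ a b n, Q a n → Q b n → a = b) → False

namespace ZFCUniverse

open AtomUniverse

variable {M : Type u} [lang.Structure M] (V : ZFCUniverse M)

def NatSubset (x : M) : Prop := ∀ z, V.mem z x → V.IsNat z

/-- The atoms of the shifted universe are the sets of natural numbers that contain zero. -/
def ShiftAtom (x : M) : Prop := V.NatSubset x ∧ V.mem V.empty x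

/-- The membership relation of the shifted universe: a set `x` of natural numbers without zero has
as its elements the predecessors of its elements. -/
def ShiftMem (y x : M) : Prop :=
  (V.NatSubset x ∧ ¬ V.mem V.empty x ∧ V.IsNat y ∧ V.mem (V.succ y) x) ∨
    (¬ V.NatSubset x ∧ V.mem y x)

instance {n : ℕ} {f : (Fin n → M) → M} [DfnFun f] : Dfn (fun v => V.NatSubset (f v)) :=
  Dfn.comp₁ (R := V.NatSubset) (inferInstanceAs (Dfn fun v : Fin 1 → M =>
    ∀ z, V.mem z (v 0) → V.IsNat z))

instance {n : ℕ} {f : (Fin n → M) → M} [DfnFun f] : Dfn (fun v => V.ShiftAtom (f v)) :=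
  inferInstanceAs (Dfn fun v => V.NatSubset (f v) ∧ V.mem V.empty (f v))

instance {n : ℕ} {f g : (Fin n → M) → M} [DfnFun f] [DfnFun g] :
    Dfn (fun v => V.ShiftMem (f v) (g v)) :=
  Dfn.comp₂ (R := V.ShiftMem) (inferInstanceAs (Dfn fun v : Fin 2 → M =>
    (V.NatSubset (v 1) ∧ ¬ V.mem V.empty (v 1) ∧ V.IsNat (v 0) ∧ V.mem (V.succ (v 0)) (v 1)) ∨
    (¬ V.NatSubset (v 1) ∧ V.mem (v 0) (v 1))))

variable {V} in
theorem ShiftMem.not_shiftAtom {x y : M} (h : V.ShiftMem y x) : ¬ V.ShiftAtom x := by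
  rintro ⟨h1, h2⟩
  rcases h with ⟨_, h, _⟩ | ⟨h, _⟩
  · exact h h2
  · exact h h1

theorem small_shiftMem (x : M) : V.Small (fun y => V.ShiftMem y x) := by
  by_cases hx : V.NatSubset x
  · exact (small_isNat V.infinity).mono _ fun y hy => by
      rcases hy with h | h
      · exact h.2.2.1
      · exact (h.1 hx).elim
  · exact (V.small_mem x).congr fun z => by simp [ShiftMem, hx]

/-- The transfer principle behind all set existence axioms. A set of natural numbers is represented
by the set of the successors of its elements, which omits 0 and so is not an atom; any other set
represents itself. -/
theorem exists_shiftMem_iff {C : M → Prop} :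
    (∃ c, ¬ V.ShiftAtom c ∧ ∀ z, V.ShiftMem z c ↔ C z) ↔ V.Small C := by
  constructor
  · rintro ⟨c, -, h⟩
    exact (V.small_shiftMem c).congr fun z => (h z).symm
  · rintro ⟨x, _, h⟩
    by_cases hx : V.NatSubset x
    · obtain ⟨c, -, hc⟩ := (V.small_mem x).image (fun y z => z = V.succ y)
        (by rintro _ _ _ rfl rfl; rfl)
      have hc1 : V.NatSubset c := by
        intro z hz
        obtain ⟨y, hy, rfl⟩ := (hc z).1 hz
        exact (hx y hy).succ
      have hc2 : ¬ V.mem V.empty c := by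
        rw [hc]
        rintro ⟨y, _, hy⟩
        exact V.succ_ne_empty y hy.symm
      refine ⟨c, fun h => hc2 h.2, fun z => ?_⟩
      simp only [ShiftMem, hc1, hc2, not_true, not_false_iff, true_and, false_and, or_false]
      rw [← h z, hc]
      constructor
      · rintro ⟨_, y, hy, e⟩
        rwa [V.succ_inj e]
      · exact fun hz => ⟨hx z hz, z, hz, rfl⟩
    · exact ⟨x, fun k => hx k.1, fun z => by simp [ShiftMem, hx, h]⟩

/-- The two kinds of non-atoms cannot agree: a recoded set has only natural numbers as new elements,
while a set left unchanged has an element that is not one. A recoded set is recovered from the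
predecessors of its elements because it omits 0. -/
theorem shift_ext {x y : M} (hx : ¬ V.ShiftAtom x) (hy : ¬ V.ShiftAtom y)
    (h : ∀ z, V.ShiftMem z x ↔ V.ShiftMem z y) : x = y := by
  have key (x y : M) (hx : V.NatSubset x) (hy : ¬ V.NatSubset y)
      (h : ∀ z, V.ShiftMem z x ↔ V.ShiftMem z y) : False := by
    refine hy fun z hz => ?_
    rcases (h z).2 (Or.inr ⟨hy, hz⟩) with k | k
    · exact k.2.2.1
    · exact (k.1 hx).elim
  by_cases hx' : V.NatSubset x <;> by_cases hy' : V.NatSubset y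
  · have hx0 : ¬ V.mem V.empty x := fun k => hx ⟨hx', k⟩
    have hy0 : ¬ V.mem V.empty y := fun k => hy ⟨hy', k⟩
    simp only [ShiftMem, hx', hy', hx0, hy0, not_true, not_false_iff, true_and, false_and,
      or_false] at h
    refine V.eq_of_mem_iff fun z => ⟨fun hz => ?_, fun hz => ?_⟩
    · rcases V.isNat_cases (hx' z hz) with rfl | ⟨k, hk, rfl⟩
      · exact (hx0 hz).elim
      · exact ((h k).1 ⟨hk, hz⟩).2
    · rcases V.isNat_cases (hy' z hz) with rfl | ⟨k, hk, rfl⟩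
      · exact (hy0 hz).elim
      · exact ((h k).2 ⟨hk, hz⟩).2
  · exact (key x y hx' hy' h).elim
  · exact (key y x hy' hx' fun z => (h z).symm).elim
  · exact V.eq_of_mem_iff fun z => by simpa [ShiftMem, hx', hy'] using h z

/-- The universe with atoms obtained by shifting the sets of natural numbers. -/
def shift : AtomUniverse M where
  mem := V.ShiftMem
  atom := V.ShiftAtom
  dfn_mem := inferInstance
  dfn_atom := inferInstance
  not_atom_of_mem := ShiftMem.not_shiftAtom
  ext := V.shift_ext
  exists_atoms := by
    rw [exists_shiftMem_iff]
    obtain ⟨w, -, hw⟩ := small_isNat V.infinity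
    exact (V.small_subset w).mono _ fun x hx y hy => (hw y).2 (hx.1 y hy)
  exists_pair x y := V.exists_shiftMem_iff.2 (V.small_pair x y)
  exists_sUnion x := V.exists_shiftMem_iff.2
    ((V.small_shiftMem x).biUnion (fun y z => V.ShiftMem z y) fun y _ => V.small_shiftMem y)
  exists_powerset x := by
    rw [exists_shiftMem_iff]
    obtain ⟨e, -, he⟩ := V.small_shiftMem x
    -- Each new subset of `x` has as its extension an old subset of `e`, the old set of the new
    -- elements of `x`. Replacement sends the old subsets `X` to the non-atoms that represent them.
    refine ((V.small_subset e).image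
      (fun X z => ¬ V.ShiftAtom z ∧ ∀ y, V.ShiftMem y z ↔ V.mem y X) ?_).congr fun z => ?_
    · exact fun X z z' h h' => V.shift_ext h.1 h'.1 fun y => (h.2 y).trans (h'.2 y).symm
    · constructor
      · rintro ⟨hz, h⟩
        obtain ⟨X, -, hX⟩ := V.small_shiftMem z
        exact ⟨X, fun y hy => (he y).2 (h y ((hX y).1 hy)), hz, fun y => (hX y).symm⟩
      · rintro ⟨X, hX, hz, h⟩
        exact ⟨hz, fun y hy => (he y).1 (hX y ((h y).1 hy))⟩
  exists_image R hR hf u := V.exists_shiftMem_iff.2 ((V.small_shiftMem u).image R hf)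

theorem shift_small_iff {C : M → Prop} : V.shift.Small C ↔ V.Small C :=
  V.exists_shiftMem_iff

/-- In the recoded case `y ∈ y + 1 ∈ x`. New membership thus descends at most two old levels, which
is how well-foundedness is inherited. -/
theorem shiftMem_cases {x y : M} (h : V.ShiftMem y x) :
    V.mem y x ∨ ∃ z, V.mem z x ∧ V.mem y z := by
  rcases h with h | h
  · exact Or.inr ⟨_, h.2.2.2, V.mem_succ.2 (Or.inr rfl)⟩
  · exact Or.inl h.2

/-- The shifted universe has its own successor operation, hence its own natural numbers. Old
recursion enumerates them by the old ones, so each of them has an old index. -/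
theorem exists_shift_isInductive : ∃ c, V.shift.IsInductive c ∧
    ∀ z, V.shift.mem z c ↔ ∃ n, V.RecVal V.shift.empty V.shift.succ n z := by
  obtain ⟨c, -, hc⟩ := V.shift_small_iff.2 (small_range_recVal V.shift.empty V.shift.succ)
  refine ⟨c, ⟨(hc _).2 ⟨_, recVal_empty _ _⟩, fun a ha => ?_⟩, hc⟩
  obtain ⟨n, hn⟩ := (hc a).1 ha
  exact (hc _).2 ⟨_, hn.succ⟩

theorem shift_no_injection (Q : M → M → Prop) (hQ : Dfn (fun v : Fin 2 → M => Q (v 0) (v 1)))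
    (tot : ∀ a, V.shift.atom a → ∃ n, V.shift.IsNat n ∧ Q a n)
    (inj : ∀ a b n, Q a n → Q b n → a = b) : False := by
  let H := V.RecVal V.shift.empty V.shift.succ
  have hH : Dfn (fun v : Fin 2 → M => H (v 0) (v 1)) := dfn_recVal _ _
  have (n : ℕ) (f g : (Fin n → M) → M) [DfnFun f] [DfnFun g] :
    Dfn (fun v => Q (f v) (g v)) := hQ.comp₂
  have (n : ℕ) (f g : (Fin n → M) → M) [DfnFun f] [DfnFun g] :
    Dfn (fun v => H (f v) (g v)) := hH.comp₂
  -- Cantor's diagonal set. It contains 0 in order to be an atom, so the diagonal runs over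
  -- successors: `n + 1` is put in when some atom without `n + 1` is related by `Q` to the new
  -- natural number of index `n`.
  obtain ⟨d, -, hd⟩ := (small_isNat V.infinity).mono (fun k => k = V.empty ∨
      ∃ n, V.IsNat n ∧ k = V.succ n ∧ ∃ m a, H n m ∧ V.ShiftAtom a ∧ Q a m ∧ ¬ V.mem k a) (by
    rintro k (rfl | ⟨n, hn, rfl, _⟩)
    · exact IsNat.empty
    · exact hn.succ)
  have hdat : V.ShiftAtom d := by
    refine ⟨fun z hz => ?_, (hd _).2 (Or.inl rfl)⟩
    rcases (hd z).1 hz with rfl | ⟨n, hn, rfl, _⟩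
    · exact IsNat.empty
    · exact hn.succ
  obtain ⟨m, hm, hdm⟩ := tot d hdat
  obtain ⟨c, hc, hcH⟩ := V.exists_shift_isInductive
  obtain ⟨n, hn⟩ := (hcH m).1 (hm c hc)
  -- Here `n` is the index of a value `m` of `d` under `Q`; by injectivity, `d` is the only atom
  -- with value `m`.
  have iff : V.mem (V.succ n) d ↔ ¬ V.mem (V.succ n) d := by
    constructor
    · intro h
      rcases (hd _).1 h with h | ⟨n', hn', e, m', a, hm', _, hQ, hna⟩
      · exact (V.succ_ne_empty n h).elim
      · obtain rfl := V.succ_inj e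
        obtain rfl := hn.unique hm'
        rwa [← inj a d m hQ hdm]
    · exact fun h => (hd _).2 (Or.inr ⟨n, hn.1, rfl, m, d, hn, hdat, hdm, h⟩)
  tauto

theorem shift_isFull : V.shift.IsFull where
  infinity := V.exists_shift_isInductive.imp fun _ h => h.1
  exists_transitive x := by
    obtain ⟨T, hx, hT⟩ := V.exists_transitive x
    obtain ⟨c, -, hc⟩ := V.shift_small_iff.2 (V.small_mem T)
    refine ⟨c, (hc x).2 hx, fun y z hy hz => (hc z).2 ?_⟩
    have hyT := (hc y).1 hy
    rcases V.shiftMem_cases hz with h | ⟨w, hw, h⟩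
    · exact hT y z hyT h
    · exact hT w z (hT y w hyT hw) h
  induction P hP h x := by
    have (n : ℕ) (f : (Fin n → M) → M) [DfnFun f] : Dfn (fun v => P (f v)) := hP.comp₁
    -- The hypothesis includes the old elements of `x`, since a new element may lie two old levels
    -- down.
    refine (V.mem_induction (fun x => P x ∧ ∀ y, V.mem y x → P y) (fun x ih => ?_) x).1
    refine ⟨h x fun y hy => ?_, fun y hy => (ih y hy).1⟩
    rcases V.shiftMem_cases hy with hy | ⟨z, hz, hy⟩
    · exact (ih y hy).1
    · exact (ih z hz).2 y hy
  choice C R hC hR hs hne := V.exists_choice (V.shift_small_iff.1 hC) R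
    (fun t ht => V.shift_small_iff.1 (hs t ht)) hne
  no_injection := V.shift_no_injection

end ZFCUniverse

end PureSets
-- Semantics of the language with atoms: substitution and isomorphisms.
namespace AtomSets

section Semantics

variable {M : Type u} (S : Str M) {n m : ℕ}

@[simp] theorem Str.eval_var (i : Fin n) (v : Fin n → M) : S.eval (Tm.var i) v = v i := by
  simp only [Str.eval]

@[simp] theorem Str.eval_pair (s t : Tm n) (v : Fin n → M) :
    S.eval (Tm.pair s t) v = S.pair (S.eval s v) (S.eval t v) := by simp only [Str.eval]

@[simp] theorem Str.eval_pow (s : Tm n) (v : Fin n → M) :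
    S.eval (Tm.pow s) v = S.pow (S.eval s v) := by simp only [Str.eval]

@[simp] theorem Str.eval_sUnion (s : Tm n) (v : Fin n → M) :
    S.eval (Tm.sUnion s) v = S.sUnion (S.eval s v) := by simp only [Str.eval]

@[simp] theorem Str.eval_compr (t : Tm n) (φ : Fm (n + 1)) (v : Fin n → M) :
    S.eval (Tm.compr t φ) v =
      S.sep (S.eval t v) {x | S.Sat φ (Fin.snoc (α := fun _ => M) v x)} := by
  simp only [Str.eval, Str.Sat]

@[simp] theorem Str.eval_empty (v : Fin n → M) : S.eval Tm.empty v = S.empty := by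
  simp only [Str.eval]

@[simp] theorem Str.eval_atoms (v : Fin n → M) : S.eval Tm.atoms v = S.atoms := by
  simp only [Str.eval]

@[simp] theorem Str.sat_eq (s t : Tm n) (v : Fin n → M) :
    S.Sat (Fm.eq s t) v ↔ S.eval s v = S.eval t v := by simp only [Str.Sat, Str.sat]

@[simp] theorem Str.sat_mem (s t : Tm n) (v : Fin n → M) :
    S.Sat (Fm.mem s t) v ↔ S.mem (S.eval s v) (S.eval t v) := by simp only [Str.Sat, Str.sat]

@[simp] theorem Str.sat_bot (v : Fin n → M) : ¬ S.Sat Fm.bot v := by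
  simp only [Str.Sat, Str.sat, not_false_iff]

@[simp] theorem Str.sat_and (φ ψ : Fm n) (v : Fin n → M) :
    S.Sat (Fm.and φ ψ) v ↔ S.Sat φ v ∧ S.Sat ψ v := by simp only [Str.Sat, Str.sat]

@[simp] theorem Str.sat_imp (φ ψ : Fm n) (v : Fin n → M) :
    S.Sat (Fm.imp φ ψ) v ↔ (S.Sat φ v → S.Sat ψ v) := by simp only [Str.Sat, Str.sat]

@[simp] theorem Str.sat_all (φ : Fm (n + 1)) (v : Fin n → M) :
    S.Sat (Fm.all φ) v ↔ ∀ x, S.Sat φ (Fin.snoc (α := fun _ => M) v x) := by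
  simp only [Str.Sat, Str.sat]

@[simp] theorem Str.sat_neg (φ : Fm n) (v : Fin n → M) : S.Sat φ.neg v ↔ ¬ S.Sat φ v := by
  simp [Fm.neg]

@[simp] theorem Str.sat_or (φ ψ : Fm n) (v : Fin n → M) :
    S.Sat (Fm.or φ ψ) v ↔ S.Sat φ v ∨ S.Sat ψ v := by
  simp only [Fm.or, sat_neg, sat_and]
  tauto

@[simp] theorem Str.sat_iff (φ ψ : Fm n) (v : Fin n → M) :
    S.Sat (Fm.iff φ ψ) v ↔ (S.Sat φ v ↔ S.Sat ψ v) := by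
  simp only [Fm.iff, sat_imp, sat_and]
  tauto

@[simp] theorem Str.sat_ex (φ : Fm (n + 1)) (v : Fin n → M) :
    S.Sat (Fm.ex φ) v ↔ ∃ x, S.Sat φ (Fin.snoc (α := fun _ => M) v x) := by
  simp [Fm.ex]

@[simp] theorem Str.sat_isSet (s : Tm n) (v : Fin n → M) :
    S.Sat (isSet s) v ↔ ¬ S.mem (S.eval s v) S.atoms := by
  simp [isSet]

theorem Str.sat_alls (φ : Fm n) : S.Sat φ.alls Fin.elim0 ↔ ∀ v, S.Sat φ v := by
  induction n with
  | zero =>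
    simp only [Fm.alls]
    exact ⟨fun h v => Subsingleton.elim Fin.elim0 v ▸ h, fun h => h _⟩
  | succ n ih =>
    simp only [Fm.alls, ih, sat_all]
    constructor
    · intro h v
      have := h (Fin.init v) (v (Fin.last n))
      rwa [Fin.snoc_init_self] at this
    · exact fun h v x => h _

theorem Str.sat_exs (k : ℕ) (φ : Fm (n + k)) (v : Fin n → M) :
    S.Sat (Fm.exs k φ) v ↔ ∃ w : Fin k → M, S.Sat φ (Fin.append v w) := by
  induction k with
  | zero =>
    simp only [Fm.exs]
    constructor
    · exact fun h => ⟨Fin.elim0, by rwa [Fin.append_elim0]⟩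
    · rintro ⟨w, hw⟩
      rw [Subsingleton.elim w Fin.elim0, Fin.append_elim0] at hw
      exact hw
  | succ k ih =>
    simp only [Fm.exs, ih, sat_ex]
    constructor
    · rintro ⟨w, x, h⟩
      refine ⟨Fin.snoc (α := fun _ => M) w x, ?_⟩
      rwa [Fin.append_snoc]
    · rintro ⟨w, h⟩
      refine ⟨Fin.init w, w (Fin.last k), ?_⟩
      rw [← Fin.snoc_init_self w, Fin.append_snoc] at h
      exact h

theorem Str.sat_conj {k : ℕ} (f : Fin k → Fm n) (v : Fin n → M) :
    S.Sat (Fm.conj f) v ↔ ∀ i, S.Sat (f i) v := by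
  induction k with
  | zero => simp [Fm.conj]
  | succ k ih => simp [Fm.conj, ih, Fin.forall_fin_succ]

theorem snoc_comp_liftRen (σ : Fin n → Fin m) (v : Fin m → M) (x : M) :
    Fin.snoc (α := fun _ => M) v x ∘ liftRen σ = Fin.snoc (α := fun _ => M) (v ∘ σ) x := by
  funext i
  refine Fin.lastCases ?_ (fun j => ?_) i <;> simp [liftRen]

mutual
theorem Str.eval_rename : ∀ {n m : ℕ} (t : Tm n) (σ : Fin n → Fin m) (v : Fin m → M),
    S.eval (t.rename σ) v = S.eval t (v ∘ σ)
  | _, _, .var i, σ, v => by simp [Tm.rename]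
  | _, _, .pair s t, σ, v => by
    simp [Tm.rename, Str.eval_rename s σ v, Str.eval_rename t σ v]
  | _, _, .pow s, σ, v => by simp [Tm.rename, Str.eval_rename s σ v]
  | _, _, .sUnion s, σ, v => by simp [Tm.rename, Str.eval_rename s σ v]
  | _, _, .compr t φ, σ, v => by
    simp [Tm.rename, Str.eval_rename t σ v, Str.sat_rename φ (liftRen σ), snoc_comp_liftRen]
  | _, _, .empty, σ, v => by simp [Tm.rename]
  | _, _, .atoms, σ, v => by simp [Tm.rename]
theorem Str.sat_rename : ∀ {n m : ℕ} (φ : Fm n) (σ : Fin n → Fin m) (v : Fin m → M),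
    S.Sat (φ.rename σ) v ↔ S.Sat φ (v ∘ σ)
  | _, _, .eq s t, σ, v => by
    simp [Fm.rename, Str.eval_rename s σ v, Str.eval_rename t σ v]
  | _, _, .mem s t, σ, v => by
    simp [Fm.rename, Str.eval_rename s σ v, Str.eval_rename t σ v]
  | _, _, .bot, σ, v => by simp [Fm.rename]
  | _, _, .and φ ψ, σ, v => by
    simp [Fm.rename, Str.sat_rename φ σ v, Str.sat_rename ψ σ v]
  | _, _, .imp φ ψ, σ, v => by
    simp [Fm.rename, Str.sat_rename φ σ v, Str.sat_rename ψ σ v]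
  | _, _, .all φ, σ, v => by
    simp [Fm.rename, Str.sat_rename φ (liftRen σ), snoc_comp_liftRen]
end

/-- A bijection that preserves membership and the denotations of terms preserves the truth of
predicates. The comprehension operation has to be preserved on definable classes only. -/
structure Str.Iso {N : Type u} (S : Str M) (S' : Str N) (e : M ≃ N) : Prop where
  mem : ∀ x y, S'.mem (e x) (e y) ↔ S.mem x y
  pair : ∀ x y, S'.pair (e x) (e y) = e (S.pair x y)
  pow : ∀ x, S'.pow (e x) = e (S.pow x)
  sUnion : ∀ x, S'.sUnion (e x) = e (S.sUnion x)
  sep : ∀ {n : ℕ} (φ : Fm (n + 1)) (v : Fin n → M) (t : M),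
    S'.sep (e t) {y | S.Sat φ (Fin.snoc (α := fun _ => M) v (e.symm y))} =
      e (S.sep t {x | S.Sat φ (Fin.snoc (α := fun _ => M) v x)})
  empty : S'.empty = e S.empty
  atoms : S'.atoms = e S.atoms

theorem comp_snoc {N : Type u} (e : M → N) (v : Fin n → M) (x : M) :
    Fin.snoc (α := fun _ => N) (e ∘ v) (e x) = e ∘ Fin.snoc (α := fun _ => M) v x := by
  funext i
  refine Fin.lastCases ?_ (fun j => ?_) i <;> simp

section Iso

variable {S} {N : Type u} {S' : Str N} {e : M ≃ N}

mutual
theorem Str.Iso.eval (h : S.Iso S' e) : ∀ {n : ℕ} (t : Tm n) (v : Fin n → M),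
    S'.eval t (e ∘ v) = e (S.eval t v)
  | _, .var i, v => by simp
  | _, .pair s t, v => by simp [Str.Iso.eval h s v, Str.Iso.eval h t v, h.pair]
  | _, .pow s, v => by simp [Str.Iso.eval h s v, h.pow]
  | _, .sUnion s, v => by simp [Str.Iso.eval h s v, h.sUnion]
  | _, .compr t φ, v => by
    simp only [Str.eval_compr, Str.Iso.eval h t v]
    rw [← h.sep]
    congr 1
    ext y
    have := Str.Iso.sat h φ (Fin.snoc (α := fun _ => M) v (e.symm y))
    rwa [← comp_snoc, Equiv.apply_symm_apply] at this
  | _, .empty, v => by simp [h.empty]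
  | _, .atoms, v => by simp [h.atoms]
theorem Str.Iso.sat (h : S.Iso S' e) : ∀ {n : ℕ} (φ : Fm n) (v : Fin n → M),
    S'.Sat φ (e ∘ v) ↔ S.Sat φ v
  | _, .eq s t, v => by simp [Str.Iso.eval h s v, Str.Iso.eval h t v]
  | _, .mem s t, v => by simp [Str.Iso.eval h s v, Str.Iso.eval h t v, h.mem]
  | _, .bot, v => by simp
  | _, .and φ ψ, v => by simp [Str.Iso.sat h φ v, Str.Iso.sat h ψ v]
  | _, .imp φ ψ, v => by simp [Str.Iso.sat h φ v, Str.Iso.sat h ψ v]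
  | _, .all φ, v => by
    simp only [Str.sat_all]
    rw [← e.forall_congr_right]
    refine forall_congr' fun x => ?_
    rw [comp_snoc]
    exact Str.Iso.sat h φ _
end

end Iso

end Semantics

/-! ### Valuations -/

section Valuations

variable {M : Type u} {n : ℕ}

@[simp] theorem snoc_elim0 (x : M) : Fin.snoc (α := fun _ => M) Fin.elim0 x = ![x] := by
  funext i; fin_cases i; rfl

@[simp] theorem snoc_vec₁ (a x : M) : Fin.snoc (α := fun _ => M) ![a] x = ![a, x] := by
  funext i; fin_cases i <;> rfl

@[simp] theorem snoc_vec₂ (a b x : M) : Fin.snoc (α := fun _ => M) ![a, b] x = ![a, b, x] := by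
  funext i; fin_cases i <;> rfl

@[simp] theorem snoc_vec₃ (a b c x : M) :
    Fin.snoc (α := fun _ => M) ![a, b, c] x = ![a, b, c, x] := by
  funext i; fin_cases i <;> rfl

@[simp] theorem snoc_vec₄ (a b c d x : M) :
    Fin.snoc (α := fun _ => M) ![a, b, c, d] x = ![a, b, c, d, x] := by
  funext i; fin_cases i <;> rfl

@[simp] theorem snoc_vec₅ (a b c d e x : M) :
    Fin.snoc (α := fun _ => M) ![a, b, c, d, e] x = ![a, b, c, d, e, x] := by
  funext i; fin_cases i <;> rfl

@[simp] theorem snoc_vec₆ (a b c d e f x : M) :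
    Fin.snoc (α := fun _ => M) ![a, b, c, d, e, f] x = ![a, b, c, d, e, f, x] := by
  funext i; fin_cases i <;> rfl

@[simp] theorem snoc_vec₇ (a b c d e f g x : M) :
    Fin.snoc (α := fun _ => M) ![a, b, c, d, e, f, g] x = ![a, b, c, d, e, f, g, x] := by
  funext i; fin_cases i <;> rfl

@[simp] theorem comp_vec₁ (v : Fin n → M) (i : Fin n) : v ∘ ![i] = ![v i] := by
  funext k; fin_cases k; rfl

@[simp] theorem comp_vec₂ (v : Fin n → M) (i j : Fin n) : v ∘ ![i, j] = ![v i, v j] := by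
  funext k; fin_cases k <;> rfl

@[simp] theorem comp_vec₃ (v : Fin n → M) (i j k : Fin n) :
    v ∘ ![i, j, k] = ![v i, v j, v k] := by
  funext l; fin_cases l <;> rfl

theorem snoc_eq_append (v : Fin n → M) (x : M) :
    Fin.snoc (α := fun _ => M) v x = Fin.append v ![x] := by
  rw [← snoc_elim0, Fin.append_snoc, Fin.append_elim0]
  rfl

theorem append_snoc' {k : ℕ} (v : Fin n → M) (w : Fin k → M) (x : M) :
    Fin.snoc (α := fun _ => M) (Fin.append v w) x =
      Fin.append v (Fin.snoc (α := fun _ => M) w x) :=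
  (Fin.append_snoc _ _ _).symm

theorem append_comp_keep {k m : ℕ} (v : Fin n → M) (w : Fin m → M) (τ : Fin k → Fin m) :
    Fin.append v w ∘ keep τ = Fin.append v (w ∘ τ) := by
  funext i
  refine Fin.addCases (fun j => ?_) (fun j => ?_) i <;> simp [keep]

end Valuations

end AtomSets
-- Universes as structures, and the axioms of ZFAC.
namespace PureSets

namespace AtomUniverse

open AtomSets

variable {M : Type u} [lang.Structure M] (U : AtomUniverse M)

/-- The universe `U` as a structure for the language of sets with atoms. -/
noncomputable def toStr : Str M where
  mem := U.mem
  pair := U.pair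
  pow := U.pow
  sUnion := U.sUnion
  sep t X := U.cls fun y => U.mem y t ∧ y ∈ X
  empty := U.empty
  atoms := U.atoms

@[simp] theorem toStr_mem : U.toStr.mem = U.mem := rfl
@[simp] theorem toStr_pair : U.toStr.pair = U.pair := rfl
@[simp] theorem toStr_pow : U.toStr.pow = U.pow := rfl
@[simp] theorem toStr_sUnion : U.toStr.sUnion = U.sUnion := rfl
@[simp] theorem toStr_sep (t : M) (X : Set M) :
    U.toStr.sep t X = U.cls fun y => U.mem y t ∧ y ∈ X := rfl
@[simp] theorem toStr_empty : U.toStr.empty = U.empty := rfl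
@[simp] theorem toStr_atoms : U.toStr.atoms = U.atoms := rfl

theorem Dfn.snoc_param {n : ℕ} {P : (Fin (n + 1) → M) → Prop} (h : Dfn P) (v : Fin n → M) :
    Dfn (fun w : Fin 1 → M => P (Fin.snoc (α := fun _ => M) v (w 0))) := by
  refine (h.subst (Fin.snoc (α := fun _ => M ⊕ Fin 1) (fun i => Sum.inl (v i)) (Sum.inr 0))).congr
    fun w => iff_of_eq (congrArg P ?_)
  funext i
  refine Fin.lastCases ?_ (fun j => ?_) i <;> simp

theorem Dfn.of_snoc {n : ℕ} {P : (Fin (n + 1) → M) → Prop} (h : Dfn P) :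
    Dfn (fun w : Fin (n + 1) → M =>
      P (Fin.snoc (α := fun _ => M) (fun i => w i.castSucc) (w (Fin.last n)))) :=
  h.congr fun w => by
    rw [show (fun i : Fin n => w i.castSucc) = Fin.init w from rfl, Fin.snoc_init_self]

theorem small_sep {n : ℕ} {P : (Fin (n + 1) → M) → Prop} (h : Dfn P) (v : Fin n → M) (t : M) :
    U.Small fun y => U.mem y t ∧ P (Fin.snoc (α := fun _ => M) v y) := by
  have := Dfn.snoc_param h v
  exact (U.small_mem t).sep fun y => P (Fin.snoc (α := fun _ => M) v y)

mutual
-- Terms and predicates are treated together because comprehension terms contain predicates. There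
-- the definability of `φ` is used twice: to make the class a set by separation, and to define its
-- graph.
theorem dfnFun_eval : ∀ {n : ℕ} (t : Tm n), DfnFun (fun v => U.toStr.eval t v)
  | _, .var i => by simp only [Str.eval_var]; infer_instance
  | _, .pair s t => by
    have := dfnFun_eval s
    have := dfnFun_eval t
    simp only [Str.eval_pair, toStr_pair]
    infer_instance
  | _, .pow s => by
    have := dfnFun_eval s
    simp only [Str.eval_pow, toStr_pow]
    infer_instance
  | _, .sUnion s => by
    have := dfnFun_eval s
    simp only [Str.eval_sUnion, toStr_sUnion]
    infer_instance
  | _, .compr t φ => by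
    have := (dfnFun_eval t).lift
    have h := dfn_sat φ
    have := Dfn.of_snoc h
    simp only [Str.eval_compr, toStr_sep, Set.mem_ofPred_eq]
    exact dfn_cls fun v => U.small_sep h v _
  | _, .empty => by simp only [Str.eval_empty]; infer_instance
  | _, .atoms => by simp only [Str.eval_atoms]; infer_instance
theorem dfn_sat : ∀ {n : ℕ} (φ : Fm n), Dfn (fun v => U.toStr.Sat φ v)
  | _, .eq s t => by
    have := dfnFun_eval s
    have := dfnFun_eval t
    simp only [Str.sat_eq]
    infer_instance
  | _, .mem s t => by
    have := dfnFun_eval s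
    have := dfnFun_eval t
    simp only [Str.sat_mem, toStr_mem]
    infer_instance
  | _, .bot => by simp only [Str.sat_bot]; infer_instance
  | _, .and φ ψ => by
    have := dfn_sat φ
    have := dfn_sat ψ
    simp only [Str.sat_and]
    infer_instance
  | _, .imp φ ψ => by
    have := dfn_sat φ
    have := dfn_sat ψ
    simp only [Str.sat_imp]
    infer_instance
  | _, .all φ => by
    have := Dfn.of_snoc (dfn_sat φ)
    simp only [Str.sat_all]
    infer_instance
end

/-! ### The axioms of ZFAC -/

@[simp] theorem eval_opair {n : ℕ} (s t : Tm n) (v : Fin n → M) :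
    U.toStr.eval (AtomSets.opair s t) v = U.opair (U.toStr.eval s v) (U.toStr.eval t v) := by
  simp [AtomSets.opair, AtomUniverse.opair]

@[simp] theorem eval_succ {n : ℕ} (s : Tm n) (v : Fin n → M) :
    U.toStr.eval (AtomSets.succ s) v = U.succ (U.toStr.eval s v) := by
  simp [AtomSets.succ, AtomUniverse.succ]

theorem sat_inductiveSet (c : M) : U.toStr.Sat inductiveSet ![c] ↔ U.IsInductive c := by
  simp [inductiveSet, IsInductive]

theorem sat_isNat (n : M) : U.toStr.Sat isNat ![n] ↔ U.IsNat n := by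
  simp [isNat, IsNat, Str.sat_rename, sat_inductiveSet]

/-- `f` is a set of ordered pairs that is single-valued. -/
def IsFun (f : M) : Prop :=
  ¬ U.atom f ∧ (∀ p, U.mem p f → ∃ a b, p = U.opair a b) ∧
    ∀ a b c, U.mem (U.opair a b) f → U.mem (U.opair a c) f → b = c

theorem sat_isFun (f : M) : U.toStr.Sat isFun ![f] ↔ U.IsFun f := by
  simp [isFun, IsFun]

theorem sat_atmEmpty : U.toStr.Sat atmEmpty Fin.elim0 := by
  simp only [atmEmpty, Str.sat_all, snoc_elim0, snoc_vec₁]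
  simp
  exact fun x y h => U.not_atom_of_mem h

theorem sat_emptySet : U.toStr.Sat emptySet Fin.elim0 := by
  simp [emptySet]

theorem sat_extensionality : U.toStr.Sat AtomSets.extensionality Fin.elim0 := by
  simp [AtomSets.extensionality]
  exact fun x y hx hy h => U.ext hx hy h

theorem sat_pairing : U.toStr.Sat AtomSets.pairing Fin.elim0 := by
  simp [AtomSets.pairing]

theorem sat_union : U.toStr.Sat AtomSets.union Fin.elim0 := by
  simp [AtomSets.union]

theorem sat_powerset : U.toStr.Sat AtomSets.powerset Fin.elim0 := by
  simp [AtomSets.powerset]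

theorem sat_comprehension (n : ℕ) (φ : Fm (n + 1)) :
    U.toStr.Sat (comprehension n φ) Fin.elim0 := by
  rw [comprehension, Str.sat_alls]
  intro v
  simp only [Str.sat_all, Str.sat_and, Str.sat_isSet, Str.sat_iff, Str.sat_mem, Str.eval_compr,
    Str.eval_var, Str.sat_rename, snoc_eq_append v, append_snoc', snoc_vec₁, snoc_vec₂,
    append_comp_keep, Fin.append_right, toStr_sep, toStr_mem, toStr_atoms, mem_atoms,
    Set.mem_ofPred_eq]
  intro t s
  have h := (U.small_sep (U.dfn_sat φ) v t).spec
  simp only [snoc_eq_append] at h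
  refine ⟨?_, ?_⟩
  · simpa using h.1
  · simpa using h.2 s

theorem sat_replacement (n : ℕ) (φ : Fm (n + 2)) :
    U.toStr.Sat (AtomSets.replacement n φ) Fin.elim0 := by
  rw [AtomSets.replacement, Str.sat_alls]
  intro v
  simp only [Str.sat_all, Str.sat_imp, Str.sat_ex, Str.sat_and, Str.sat_iff, Str.sat_mem,
    Str.sat_eq,
    Str.eval_var, Str.sat_rename, snoc_eq_append v, append_snoc', snoc_vec₁, snoc_vec₂, snoc_vec₃,
    append_comp_keep, Fin.append_right, toStr_mem]
  intro u hf
  have hd : Dfn (fun w : Fin 2 → M => U.toStr.Sat φ (Fin.append v ![w 0, w 1])) := by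
    refine ((U.dfn_sat φ).subst (Fin.append (fun i => Sum.inl (v i)) ![Sum.inr 0, Sum.inr 1])).congr
      fun w => iff_of_eq (congrArg _ ?_)
    funext i
    refine Fin.addCases (fun j => ?_) (fun j => ?_) i
    · simp
    · fin_cases j <;> simp
  obtain ⟨b, -, hb⟩ := U.exists_image (fun x y => U.toStr.Sat φ (Fin.append v ![x, y])) hd
    (fun x y y' h h' => by simpa using hf x y y' (by simpa using h) (by simpa using h')) u
  exact ⟨b, fun a => by simpa using hb a⟩

variable {U}

theorem IsFull.sat_infinity (hU : U.IsFull) : U.toStr.Sat AtomSets.infinity Fin.elim0 := by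
  simp only [AtomSets.infinity, Str.sat_ex, snoc_elim0, sat_inductiveSet]
  exact hU.infinity

theorem IsFull.sat_induction (hU : U.IsFull) (φ : Fm 1) :
    U.toStr.Sat (AtomSets.induction φ) Fin.elim0 := by
  have h := hU.induction (fun x => U.toStr.Sat φ ![x])
    ((U.dfn_sat φ).congr fun v => iff_of_eq (congrArg _ (by funext i; fin_cases i; rfl)))
  simpa [AtomSets.induction, Str.sat_rename] using h

theorem IsFull.sat_atmInf (hU : U.IsFull) : U.toStr.Sat atmInf Fin.elim0 := by
  simp only [atmInf, Str.sat_neg, Str.sat_ex, snoc_elim0]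
  rintro ⟨f, hf⟩
  simp [injAtomsNat, isInj, Str.sat_rename, sat_isNat] at hf
  obtain ⟨_, inj, ran, tot⟩ := hf
  refine hU.no_injection (fun a n => U.mem (U.opair a n) f) inferInstance (fun a ha => ?_) inj
  obtain ⟨n, hn⟩ := tot a ha
  exact ⟨n, (ran a n hn).2, hn⟩

theorem IsFull.sat_choice (hU : U.IsFull) : U.toStr.Sat AtomSets.choice Fin.elim0 := by
  simp only [AtomSets.choice, Str.sat_ex, Str.sat_all, snoc_elim0, snoc_vec₁, isChoiceFun]
  simp [Str.sat_rename, sat_isFun]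
  intro s
  obtain ⟨Q, hQ, h⟩ := hU.choice (fun t => (∀ y, U.mem y t → U.mem y s) ∧ ∃ y, U.mem y t)
    (fun t y => U.mem y t) ((U.small_subset s).sep _) inferInstance (fun t _ => U.small_mem t)
    fun t ht => ht.2
  have (n : ℕ) (f g : (Fin n → M) → M) [DfnFun f] [DfnFun g] :
    Dfn (fun v => Q (f v) (g v)) := hQ.comp₂
  -- The choice function-set is the image of the nonempty subsets `t` of `s` under `t ↦ (t, y)`,
  -- where `y` is the chosen element.
  obtain ⟨f, hfs, hf⟩ := ((U.small_subset s).sep fun t => ∃ y, U.mem y t).image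
    (fun t p => ((∀ y, U.mem y t → U.mem y s) ∧ ∃ y, U.mem y t) ∧
      ∃ y, (U.mem y t ∧ Q t y) ∧ p = U.opair t y) (by
    rintro t _ _ ⟨ht, y, hy, rfl⟩ ⟨-, y', hy', rfl⟩
    rw [(h t ht).unique hy hy'])
  have key (t y : M) : U.mem (U.opair t y) f ↔
      ((∀ y, U.mem y t → U.mem y s) ∧ ∃ y, U.mem y t) ∧ U.mem y t ∧ Q t y := by
    rw [hf]
    constructor
    · rintro ⟨t', -, ht, y', hy, e⟩
      obtain ⟨rfl, rfl⟩ := U.opair_inj.1 e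
      exact ⟨ht, hy⟩
    · exact fun k => ⟨t, k.1, k.1, y, k.2, rfl⟩
  refine ⟨f, ⟨hfs, fun p hp => ?_, fun t y z hy hz => ?_⟩, fun t y hy => ?_, fun t ht y hy => ?_⟩
  · obtain ⟨t, -, -, y, -, rfl⟩ := (hf p).1 hp
    exact ⟨t, y, rfl⟩
  · rw [key] at hy hz
    exact (h t hy.1).unique hy.2 hz.2
  · rw [key] at hy
    exact ⟨hy.1.1, hy.2.1⟩
  · obtain ⟨z, hz, -⟩ := h t ⟨ht, y, hy⟩
    exact ⟨z, (key t z).2 ⟨⟨ht, y, hy⟩, hz⟩⟩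

theorem IsFull.models_ZFAC (hU : U.IsFull) : U.toStr.Models ZFAC := by
  rintro σ (((((h | h | h | h | h | h | h | h) | ⟨n, φ, rfl⟩) | ⟨φ, rfl⟩) | ⟨n, φ, rfl⟩) | h)
  · exact h ▸ U.sat_atmEmpty
  · exact h ▸ U.sat_emptySet
  · exact h ▸ U.sat_extensionality
  · exact h ▸ U.sat_pairing
  · exact h ▸ U.sat_union
  · exact h ▸ U.sat_powerset
  · exact h ▸ hU.sat_infinity
  · exact h ▸ hU.sat_atmInf
  · exact U.sat_comprehension n φ
  · exact hU.sat_induction φ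
  · exact U.sat_replacement n φ
  · exact h ▸ hU.sat_choice

end AtomUniverse

end PureSets
-- The pointwise action of a permutation, and equivariance.
namespace PureSets

namespace AtomUniverse

open AtomSets

section Automorphism

variable {M : Type u} [lang.Structure M] {U : AtomUniverse M} {e : M ≃ M}

theorem Small.map_equiv (hmem : ∀ x y, U.mem (e x) (e y) ↔ U.mem x y)
    (hatom : ∀ x, U.atom (e x) ↔ U.atom x) {C : M → Prop} (hC : U.Small C) :
    U.cls (fun y => C (e.symm y)) = e (U.cls C) := by
  have h : ¬ U.atom (e (U.cls C)) ∧ ∀ z, U.mem z (e (U.cls C)) ↔ C (e.symm z) :=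
    ⟨fun k => hC.spec.1 ((hatom _).1 k), fun z => by
      rw [← hC.spec.2, ← hmem (e.symm z), Equiv.apply_symm_apply]⟩
  exact ((Small.eq_cls_iff ⟨_, h⟩ _).2 h).symm

/-- Every operation yields the set of a class described through membership and atoms, so a bijection
that preserves these two commutes with it. -/
theorem toStr_iso (hmem : ∀ x y, U.mem (e x) (e y) ↔ U.mem x y)
    (hatom : ∀ x, U.atom (e x) ↔ U.atom x) : U.toStr.Iso U.toStr e where
  mem := hmem
  pair x y := by
    change U.cls _ = e (U.cls _)
    rw [← (U.small_pair x y).map_equiv hmem hatom]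
    simp only [Equiv.symm_apply_eq]
  pow x := by
    change U.cls _ = e (U.cls _)
    rw [← (U.small_subset x).map_equiv hmem hatom]
    congr 1
    funext z
    rw [← e.forall_congr_right]
    refine propext (forall_congr' fun y => ?_)
    rw [hmem, ← hmem y (e.symm z), Equiv.apply_symm_apply]
  sUnion x := by
    change U.cls _ = e (U.cls _)
    rw [← (U.small_sUnion x).map_equiv hmem hatom]
    congr 1
    funext z
    rw [← e.exists_congr_right]
    refine propext (exists_congr fun y => ?_)
    rw [hmem, ← hmem (e.symm z) y, Equiv.apply_symm_apply]
  sep φ v t := by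
    change U.cls _ = e (U.cls _)
    -- For an arbitrary class `cls` may return a default value, which `e` has no reason to respect;
    -- a class defined by a predicate is small.
    have h := (U.small_sep (U.dfn_sat φ) v t).map_equiv hmem hatom
    refine Eq.trans ?_ h
    congr 1
    funext z
    rw [← hmem (e.symm z), Equiv.apply_symm_apply]
    rfl
  empty := by
    change U.cls _ = e (U.cls _)
    rw [← U.small_false.map_equiv hmem hatom]
  atoms := by
    change U.cls _ = e (U.cls _)
    rw [← U.small_atom.map_equiv hmem hatom]
    congr 1
    funext z
    rw [← hatom (e.symm z), Equiv.apply_symm_apply]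

end Automorphism

variable {M : Type u} [lang.Structure M] (U : AtomUniverse M)

/-- `p` is a function-set that is a bijection on the atoms. -/
structure IsPerm (p : M) : Prop where
  isFun : U.IsFun p
  inj : ∀ a b c, U.mem (U.opair a c) p → U.mem (U.opair b c) p → a = b
  atoms : ∀ a b, U.mem (U.opair a b) p → U.atom a ∧ U.atom b
  total : ∀ a, U.atom a → ∃ b, U.mem (U.opair a b) p
  surj : ∀ b, U.atom b → ∃ a, U.mem (U.opair a b) p

theorem IsPerm.of_sat {p : M} (h : U.toStr.Sat isPerm ![p]) : U.IsPerm p := by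
  simp only [isPerm, isInj, Str.sat_and, sat_isFun] at h
  simp at h
  obtain ⟨h1, h2, h3, h4, h5⟩ := h
  exact ⟨h1, h2, h3, h4, h5⟩

/-- The function-set `g` obeys the equations of the pointwise action of `p`, and its domain
contains the elements of its elements. -/
def ActsAs (p g : M) : Prop :=
  U.IsFun g ∧ ∀ a b, U.mem (U.opair a b) g →
    (U.atom a → U.mem (U.opair a b) p) ∧
    (¬ U.atom a → ¬ U.atom b ∧ (∀ z, U.mem z a → ∃ w, U.mem (U.opair z w) g) ∧
      ∀ w, U.mem w b ↔ ∃ z, U.mem z a ∧ U.mem (U.opair z w) g)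

/-- The pointwise action of `p` maps `x` to `y`. -/
def Act (p x y : M) : Prop := ∃ g, U.ActsAs p g ∧ U.mem (U.opair x y) g

theorem sat_isAct (p x y : M) : U.toStr.Sat isAct ![p, x, y] ↔ U.Act p x y := by
  simp [isAct, Act, ActsAs, Str.sat_rename, sat_isFun, and_assoc]
  exact exists_congr fun g => and_congr_right fun _ => and_comm

instance {n : ℕ} {f g k : (Fin n → M) → M} [DfnFun f] [DfnFun g] [DfnFun k] :
    Dfn (fun v => U.Act (f v) (g v) (k v)) := by
  refine Dfn.comp₃ (R := U.Act) ?_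
  unfold Act ActsAs IsFun
  infer_instance

variable {U} {p x y : M}

theorem Act.of_atom (h : U.Act p x y) (hx : U.atom x) : U.mem (U.opair x y) p := by
  obtain ⟨g, hg, hxy⟩ := h
  exact (hg.2 x y hxy).1 hx

theorem Act.of_set (h : U.Act p x y) (hx : ¬ U.atom x) :
    ¬ U.atom y ∧ (∀ z, U.mem z x → ∃ w, U.mem w y ∧ U.Act p z w) ∧
      ∀ w, U.mem w y → ∃ z, U.mem z x ∧ U.Act p z w := by
  obtain ⟨g, hg, hxy⟩ := h
  obtain ⟨hy, h1, h2⟩ := (hg.2 x y hxy).2 hx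
  refine ⟨hy, fun z hz => ?_, fun w hw => ?_⟩
  · obtain ⟨w, hw⟩ := h1 z hz
    exact ⟨w, (h2 w).2 ⟨z, hz, hw⟩, g, hg, hw⟩
  · obtain ⟨z, hz, hw⟩ := (h2 w).1 hw
    exact ⟨z, hz, g, hg, hw⟩

section Action

variable (hU : U.IsFull) (hp : U.IsPerm p)
include hU hp

/-- The two values may come from different witnesses `g`, each covering only part of the universe;
∈-induction on `x` reconciles them. -/
theorem Act.unique {y' : M} (h : U.Act p x y) (h' : U.Act p x y') : y = y' := by
  refine hU.induction (fun x => ∀ y y', U.Act p x y → U.Act p x y' → y = y') inferInstance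
    (fun x ih y y' h h' => ?_) x y y' h h'
  by_cases hx : U.atom x
  · exact hp.isFun.2.2 x y y' (h.of_atom hx) (h'.of_atom hx)
  · have sub (y y' : M) (h : U.Act p x y) (h' : U.Act p x y') (w : M) (hw : U.mem w y) :
        U.mem w y' := by
      obtain ⟨z, hz, hzw⟩ := (h.of_set hx).2.2 w hw
      obtain ⟨w', hw', hzw'⟩ := (h'.of_set hx).2.1 z hz
      rwa [ih z hz w w' hzw hzw']
    exact U.ext (h.of_set hx).1 (h'.of_set hx).1 fun w => ⟨sub y y' h h' w, sub y' y h' h w⟩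

/-- The action sends atoms to atoms and sets to sets, so `x` and `x'` are of the same kind. Atoms
are settled by the injectivity of `p`, sets by ∈-induction and extensionality. -/
theorem Act.injective {x' : M} (h : U.Act p x y) (h' : U.Act p x' y) : x = x' := by
  refine hU.induction (fun x => ∀ x' y, U.Act p x y → U.Act p x' y → x = x') inferInstance
    (fun x ih x' y h h' => ?_) x x' y h h'
  by_cases hx : U.atom x
  · have hxy := h.of_atom hx
    have hx' : U.atom x' := by
      by_contra hx'
      exact (h'.of_set hx').1 (hp.atoms _ _ hxy).2
    exact hp.inj x x' y hxy (h'.of_atom hx')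
  · have hx' : ¬ U.atom x' := fun hx' =>
      (h.of_set hx).1 (hp.atoms _ _ (h'.of_atom hx')).2
    refine U.ext hx hx' fun z => ⟨fun hz => ?_, fun hz => ?_⟩
    · obtain ⟨w, hw, hzw⟩ := (h.of_set hx).2.1 z hz
      obtain ⟨z', hz', hzw'⟩ := (h'.of_set hx').2.2 w hw
      rwa [ih z hz z' w hzw hzw']
    · obtain ⟨w, hw, hzw⟩ := (h'.of_set hx').2.1 z hz
      obtain ⟨z', hz', hzw'⟩ := (h.of_set hx).2.2 w hw
      rwa [← ih z' hz' z w hzw' hzw]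

/-- The action of `p` on the elements of a transitive set. -/
theorem exists_actsAs {T : M} (hT : ∀ y z, U.mem y T → U.mem z y → U.mem z T) :
    ∃ g, U.ActsAs p g ∧
      ∀ z w, U.mem (U.opair z w) g ↔ U.mem z T ∧ U.Act p z w := by
  obtain ⟨g, hgs, hg⟩ := (U.small_mem T).image (fun z q => ∃ w, U.Act p z w ∧ q = U.opair z w)
    (by
      rintro z _ _ ⟨w, hw, rfl⟩ ⟨w', hw', rfl⟩
      rw [Act.unique hU hp hw hw'])
  have key (z w : M) : U.mem (U.opair z w) g ↔ U.mem z T ∧ U.Act p z w := by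
    rw [hg]
    constructor
    · rintro ⟨z', hz, w', hw, e⟩
      obtain ⟨rfl, rfl⟩ := U.opair_inj.1 e
      exact ⟨hz, hw⟩
    · exact fun h => ⟨z, h.1, w, h.2, rfl⟩
  refine ⟨g, ⟨⟨hgs, fun q hq => ?_, fun a b c hb hc => ?_⟩, fun a b hab => ⟨fun ha => ?_,
    fun ha => ?_⟩⟩, key⟩
  · obtain ⟨z, -, w, -, rfl⟩ := (hg q).1 hq
    exact ⟨z, w, rfl⟩
  · exact Act.unique hU hp ((key a b).1 hb).2 ((key a c).1 hc).2
  · exact ((key a b).1 hab).2.of_atom ha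
  · obtain ⟨haT, hab⟩ := (key a b).1 hab
    obtain ⟨hb, h1, h2⟩ := hab.of_set ha
    refine ⟨hb, fun z hz => ?_, fun w => ⟨fun hw => ?_, ?_⟩⟩
    · obtain ⟨w, _, hw⟩ := h1 z hz
      exact ⟨w, (key z w).2 ⟨hT a z haT hz, hw⟩⟩
    · obtain ⟨z, hz, hzw⟩ := h2 w hw
      exact ⟨z, hz, (key z w).2 ⟨hT a z haT hz, hzw⟩⟩
    · rintro ⟨z, hz, hzw⟩
      obtain ⟨w', hw', hzw'⟩ := h1 z hz
      rwa [Act.unique hU hp ((key z w).1 hzw).2 hzw']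

/-- The action of `p` has a value at `x` if it has values at the elements of `x`. -/
theorem Act.exists_of_mem {T : M} (hT : ∀ y z, U.mem y T → U.mem z y → U.mem z T)
    (hxT : U.mem x T) (ih : ∀ z, U.mem z x → ∃ w, U.Act p z w) : ∃ y, U.Act p x y := by
  by_contra hx
  -- Assuming that there is no value at `x`, the action on `T` has no pair with first entry `x`, so
  -- it can be extended by one pair `(x, y)`.
  obtain ⟨g, hg, key⟩ := exists_actsAs hU hp hT
  have hgx (w : M) : ¬ U.mem (U.opair x w) g := fun h => hx ⟨w, ((key x w).1 h).2⟩
  obtain ⟨y, hy1, hy2⟩ : ∃ y, (U.atom x → U.mem (U.opair x y) p) ∧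
      (¬ U.atom x → ¬ U.atom y ∧ ∀ w, U.mem w y ↔ ∃ z, U.mem z x ∧ U.Act p z w) := by
    by_cases ha : U.atom x
    · obtain ⟨y, hy⟩ := hp.total x ha
      exact ⟨y, fun _ => hy, fun h => (h ha).elim⟩
    · obtain ⟨y, hy⟩ := (U.small_mem x).image (fun z w => U.Act p z w)
        fun _ _ _ h h' => Act.unique hU hp h h'
      exact ⟨y, fun h => (ha h).elim, fun _ => hy⟩
  obtain ⟨k, hks, hk⟩ := (U.small_mem g).or (U.small_pair (U.opair x y) (U.opair x y))
  simp only [or_self] at hk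
  have hgk (z w : M) (hz : z ≠ x) : U.mem (U.opair z w) k ↔ U.mem (U.opair z w) g := by
    simp [hk, hz]
  have hxk (w : M) : U.mem (U.opair x w) k ↔ w = y := by simp [hk, hgx]
  -- The domain of `g` is closed under elements and omits `x`, so `x` is an element of nothing in
  -- it; the new pair leaves the old equations intact.
  have hne {a z : M} (ha : ∃ b, U.mem (U.opair a b) g) (hz : U.mem z a) : z ≠ x := by
    rintro rfl
    obtain ⟨b, hb⟩ := ha
    by_cases haa : U.atom a
    · exact U.not_atom_of_mem hz haa
    · obtain ⟨w, hw⟩ := ((hg.2 a b hb).2 haa).2.1 z hz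
      exact hgx w hw
  have hxx : ∀ z, U.mem z x → z ≠ x := by
    rintro z hz rfl
    exact hx (ih z hz)
  refine hx ⟨y, k, ⟨⟨hks, fun q hq => ?_, fun a b c hb hc => ?_⟩, fun a b hab => ?_⟩,
    (hxk y).2 rfl⟩
  · rcases (hk q).1 hq with h | rfl
    · exact hg.1.2.1 q h
    · exact ⟨x, y, rfl⟩
  · by_cases ha : a = x
    · subst ha
      rw [(hxk b).1 hb, (hxk c).1 hc]
    · exact hg.1.2.2 a b c ((hgk a b ha).1 hb) ((hgk a c ha).1 hc)
  · by_cases ha : a = x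
    · subst ha
      obtain rfl := (hxk b).1 hab
      refine ⟨hy1, fun ha => ⟨(hy2 ha).1, fun z hz => ?_, fun w => ?_⟩⟩
      · obtain ⟨w, hw⟩ := ih z hz
        exact ⟨w, (hgk z w (hxx z hz)).2 ((key z w).2 ⟨hT a z hxT hz, hw⟩)⟩
      · rw [(hy2 ha).2]
        refine exists_congr fun z => and_congr_right fun hz => ?_
        rw [hgk z w (hxx z hz), key]
        exact ⟨fun h => ⟨hT a z hxT hz, h⟩, fun h => h.2⟩
    · have habg := (hgk a b ha).1 hab
      obtain ⟨h1, h2⟩ := hg.2 a b habg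
      refine ⟨h1, fun haa => ⟨(h2 haa).1, fun z hz => ?_, fun w => ?_⟩⟩
      · obtain ⟨w, hw⟩ := (h2 haa).2.1 z hz
        exact ⟨w, (hgk z w (hne ⟨b, habg⟩ hz)).2 hw⟩
      · rw [(h2 haa).2.2]
        exact exists_congr fun z => and_congr_right fun hz =>
          (hgk z w (hne ⟨b, habg⟩ hz)).symm

theorem exists_act (x : M) : ∃ y, U.Act p x y := by
  obtain ⟨T, hx, hT⟩ := hU.exists_transitive x
  -- Relativizing to one transitive set `T` lets the values at all elements of `a` be collected in a
  -- single witness.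
  refine hU.induction (fun a => U.mem a T → ∃ y, U.Act p a y) inferInstance
    (fun a ih ha => ?_) x hx
  exact Act.exists_of_mem hU hp hT ha fun z hz => ih z hz (hT a z ha hz)

/-- By ∈-induction: the preimages of the elements of `y` form a set by replacement along the inverse
action, functional by injectivity, and this set is mapped to `y`. -/
theorem act_surjective (y : M) : ∃ x, U.Act p x y := by
  refine hU.induction (fun y => ∃ x, U.Act p x y) inferInstance (fun y ih => ?_) y
  by_cases hy : U.atom y
  · obtain ⟨x, hx⟩ := hp.surj y hy
    obtain ⟨y', hy'⟩ := exists_act hU hp x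
    have := hy'.of_atom (hp.atoms _ _ hx).1
    exact ⟨x, hp.isFun.2.2 x y' y this hx ▸ hy'⟩
  · obtain ⟨x, hxs, hx⟩ := (U.small_mem y).image (fun w z => U.Act p z w)
      fun _ _ _ h h' => Act.injective hU hp h h'
    obtain ⟨y', hy'⟩ := exists_act hU hp x
    obtain ⟨hys, h1, h2⟩ := hy'.of_set hxs
    refine ⟨x, U.ext hys hy (fun w => ⟨fun hw => ?_, fun hw => ?_⟩) ▸ hy'⟩
    · obtain ⟨z, hz, hzw⟩ := h2 w hw
      obtain ⟨w', hw', hzw'⟩ := (hx z).1 hz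
      rwa [Act.unique hU hp hzw hzw']
    · obtain ⟨z, hz⟩ := ih w hw
      obtain ⟨w', hw', hzw'⟩ := h1 z ((hx z).2 ⟨w, hw, hz⟩)
      rwa [Act.unique hU hp hz hzw']

/-- A permutation of the atoms extends to an automorphism, its pointwise action. -/
theorem exists_automorphism : ∃ e : M ≃ M, (∀ x, U.Act p x (e x)) ∧ U.toStr.Iso U.toStr e := by
  choose G hG using exists_act hU hp
  have hbij : Function.Bijective G := by
    refine ⟨fun x x' h => Act.injective hU hp (hG x) (h ▸ hG x'), fun y => ?_⟩
    obtain ⟨x, hx⟩ := act_surjective hU hp y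
    exact ⟨x, Act.unique hU hp (hG x) hx⟩
  refine ⟨Equiv.ofBijective G hbij, hG, ?_⟩
  have hatom (x : M) : U.atom (G x) ↔ U.atom x := by
    refine ⟨fun h => ?_, fun h => (hp.atoms _ _ ((hG x).of_atom h)).2⟩
    by_contra hx
    exact ((hG x).of_set hx).1 h
  refine toStr_iso (fun x y => ?_) hatom
  change U.mem (G x) (G y) ↔ _
  constructor
  · intro h
    have hy : ¬ U.atom y := fun hy => U.not_atom_of_mem h ((hatom y).2 hy)
    obtain ⟨z, hz, hzx⟩ := ((hG y).of_set hy).2.2 _ h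
    rwa [Act.injective hU hp (hG x) hzx]
  · intro h
    obtain ⟨w, hw, hxw⟩ := ((hG y).of_set (U.not_atom_of_mem h)).2.1 x h
    rwa [Act.unique hU hp (hG x) hxw]

end Action

/-- The witnesses are the images of the variables under the automorphism extending the permutation;
automorphisms preserve truth. -/
theorem IsFull.sat_equivar (hU : U.IsFull) (n : ℕ) (φ : Fm n) :
    U.toStr.Sat (equivar n φ) Fin.elim0 := by
  rw [equivar, Str.sat_alls]
  intro v
  simp only [Str.sat_all, Str.sat_imp, Str.sat_exs, Str.sat_and, Str.sat_conj, Str.sat_iff,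
    Str.sat_rename, comp_vec₁, comp_vec₃, Fin.snoc_last, Fin.append_left, Fin.append_right,
    Fin.snoc_castSucc, sat_isAct]
  intro p hp
  obtain ⟨e, he, hiso⟩ := exists_automorphism hU (IsPerm.of_sat U hp)
  refine ⟨e ∘ v, fun i => he (v i), ?_⟩
  have := Str.Iso.sat hiso φ v
  convert this.symm using 2
  · funext i; simp
  · funext i; simp

theorem IsFull.models_EZFAC (hU : U.IsFull) : U.toStr.Models EZFAC := by
  rintro σ (h | ⟨n, φ, rfl⟩)
  · exact hU.models_ZFAC σ h
  · exact hU.sat_equivar n φ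

end AtomUniverse

end PureSets
-- Models of ZFC as universes, and the formulas of the class model.
namespace PureSets

open FirstOrder FirstOrder.Language AtomSets

@[simp] theorem snoc_default {M : Type u} (x : M) :
    Fin.snoc (α := fun _ => M) (default : Fin 0 → M) x = ![x] := by
  rw [Subsingleton.elim default Fin.elim0, snoc_elim0]

section Realization

variable {M : Type u} [lang.Structure M]

/-- The interpretation of the membership symbol. -/
def Elem (x y : M) : Prop := Structure.RelMap memSym ![x, y]

/-- The atomic formula `t ∈ s`, with free variables in any type. -/
def memFml {α : Type*} {m : ℕ} (t s : lang.Term (α ⊕ Fin m)) : lang.BoundedFormula α m :=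
  Relations.boundedFormula₂ memSym t s

@[simp] theorem realize_memFml {α : Type*} {m : ℕ} (t s : lang.Term (α ⊕ Fin m)) (v : α → M)
    (xs : Fin m → M) : (memFml t s).Realize v xs ↔
      Elem (t.realize (Sum.elim v xs)) (s.realize (Sum.elim v xs)) :=
  BoundedFormula.realize_rel₂

@[simp] theorem realize_mem {m : ℕ} (t s : lang.Term (Empty ⊕ Fin m)) (v : Empty → M)
    (xs : Fin m → M) : (PureSets.mem t s).Realize v xs ↔
      Elem (t.realize (Sum.elim v xs)) (s.realize (Sum.elim v xs)) :=
  BoundedFormula.realize_rel₂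

theorem realize_inst {k m : ℕ} (φ : lang.Formula (Fin k)) (σ : Fin k → Fin m) (v : Empty → M)
    (xs : Fin m → M) : (inst φ σ).Realize v xs ↔ φ.Realize (xs ∘ σ) := by
  rw [inst, BoundedFormula.realize_relabel]
  exact iff_of_eq (congrArg₂ _ rfl (Subsingleton.elim _ _))

/-- The free variable number `i`. -/
abbrev freeVar {k m : ℕ} (i : Fin k) : lang.Term (Fin k ⊕ Fin m) := Term.var (Sum.inl i)

/-- The variable `&1` is an inductive set. -/
def inductiveFml {k : ℕ} : lang.BoundedFormula (Fin k) 2 :=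
  (∃' (memFml &2 &1 ⊓ ∀' ∼(memFml &3 &2))) ⊓
    ∀' (memFml &2 &1 ⟹ ∃' (memFml &3 &1 ⊓ ∀' (memFml &4 &3 ⇔ (memFml &4 &2 ⊔ (&4 =' &2)))))

/-- The variable `&0` is a natural number. -/
def natFml {k : ℕ} : lang.BoundedFormula (Fin k) 1 :=
  ∀' (inductiveFml ⟹ memFml &0 &1)

/-- The free variable `i` is a set of natural numbers. -/
def natSubsetFml {k : ℕ} (i : Fin k) : lang.Formula (Fin k) :=
  ∀' (memFml &0 (freeVar i) ⟹ natFml)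

/-- The free variable `i` contains the empty set. -/
def containsEmptyFml {k : ℕ} (i : Fin k) : lang.Formula (Fin k) :=
  ∃' (memFml &0 (freeVar i) ⊓ ∀' ∼(memFml &1 &0))

/-- The atoms of the class model are the sets of natural numbers that contain zero. -/
def atomFml : lang.Formula (Fin 1) := natSubsetFml 0 ⊓ containsEmptyFml 0

/-- The membership relation of the class model. -/
def shiftMemFml : lang.Formula (Fin 2) :=
  (natSubsetFml 1 ⊓ (∼(containsEmptyFml 1) ⊓ ((∃' ((&0 =' freeVar 0) ⊓ natFml)) ⊓
    ∃' (memFml &0 (freeVar 1) ⊓ ∀' (memFml &1 &0 ⇔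
      (memFml &1 (freeVar 0) ⊔ (&1 =' freeVar 0))))))) ⊔
  (∼(natSubsetFml 1) ⊓ memFml (freeVar 0) (freeVar 1))

end Realization

section Base

variable {M : Type u} [lang.Structure M] (hM : FirstOrder.Language.Theory.Model M ZFC)
include hM

theorem elem_ext {x y : M} (h : ∀ z, Elem z x ↔ Elem z y) : x = y := by
  have := hM.realize_of_mem extensionality (by simp [ZFC])
  simp [Sentence.Realize, Formula.Realize, extensionality] at this
  exact this x y h

theorem elem_foundation (x : M) (h : ∃ y, Elem y x) :
    ∃ y, Elem y x ∧ ∀ z, ¬ (Elem z x ∧ Elem z y) := by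
  have := hM.realize_of_mem foundation (by simp [ZFC])
  simp [Sentence.Realize, Formula.Realize, foundation] at this
  obtain ⟨y, hy⟩ := h
  simpa using this x y hy

theorem exists_elem_pair (x y : M) : ∃ c, ∀ z, Elem z c ↔ z = x ∨ z = y := by
  have := hM.realize_of_mem pairing (by simp [ZFC])
  simp [Sentence.Realize, Formula.Realize, pairing] at this
  exact this x y

theorem exists_elem_sUnion (x : M) : ∃ c, ∀ z, Elem z c ↔ ∃ y, Elem y x ∧ Elem z y := by
  have := hM.realize_of_mem union (by simp [ZFC])
  simp [Sentence.Realize, Formula.Realize, union] at this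
  exact this x

theorem exists_elem_powerset (x : M) : ∃ c, ∀ z, Elem z c ↔ ∀ y, Elem y z → Elem y x := by
  have := hM.realize_of_mem powerset (by simp [ZFC])
  simp [Sentence.Realize, Formula.Realize, powerset] at this
  exact this x

theorem exists_elem_inductive : ∃ c : M, (∃ e, Elem e c ∧ ∀ z, ¬ Elem z e) ∧
    ∀ a, Elem a c → ∃ b, Elem b c ∧ ∀ z, Elem z b ↔ Elem z a ∨ z = a := by
  have := hM.realize_of_mem infinity (by simp [ZFC])
  simp [Sentence.Realize, Formula.Realize, infinity] at this
  exact this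

theorem exists_elem_transversal (s : M) (h1 : ∀ x, Elem x s → ∃ y, Elem y x)
    (h2 : ∀ x y, Elem x s → Elem y s → (∃ z, Elem z x ∧ Elem z y) → x = y) :
    ∃ c, ∀ x, Elem x s → ∃ z, (Elem z x ∧ Elem z c) ∧ ∀ w, Elem w x ∧ Elem w c → w = z := by
  have := hM.realize_of_mem choice (by simp [ZFC])
  simp only [Sentence.Realize, Formula.Realize, choice, BoundedFormula.realize_all,
    BoundedFormula.realize_imp, BoundedFormula.realize_ex, BoundedFormula.realize_inf,
    realize_mem, BoundedFormula.realize_bdEqual, snoc_default, snoc_vec₁,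
    snoc_vec₂, snoc_vec₃, snoc_vec₄] at this
  exact this s h1 fun x y h => h2 x y h.1 h.2

theorem exists_elem_image (R : M → M → Prop) (hR : Dfn (fun v : Fin 2 → M => R (v 0) (v 1)))
    (hf : ∀ x y y', R x y → R x y' → y = y') (u : M) :
    ∃ c, ∀ y, Elem y c ↔ ∃ x, Elem x u ∧ R x y := by
  -- A definable relation uses finitely many parameters, so a single instance of the replacement
  -- scheme applies to it.
  obtain ⟨n, φ, p, h⟩ := hR.exists_params
  have := hM.realize_of_mem (replacement n φ) (Or.inr ⟨n, φ, rfl⟩)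
  rw [replacement, Sentence.Realize, Formula.Realize] at this
  replace this := BoundedFormula.realize_alls.1 this p u
  have hkeep {m : ℕ} (xs : Fin m → M) (i j : Fin m) :
      φ.Realize (Fin.append p xs ∘ keep ![i, j]) ↔ R (xs i) (xs j) := by
    rw [append_comp_keep, comp_vec₂]
    exact (h ![xs i, xs j]).symm
  simp only [BoundedFormula.realize_all,
    BoundedFormula.realize_imp, BoundedFormula.realize_ex, BoundedFormula.realize_inf,
    BoundedFormula.realize_iff, realize_inst,
    realize_mem, BoundedFormula.realize_bdEqual, snoc_eq_append p, append_snoc', snoc_vec₁,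
    snoc_vec₂, snoc_vec₃] at this
  have hvar {m : ℕ} (v : Empty → M) (xs : Fin m → M) (i : Fin m) :
      Term.realize (Sum.elim v (Fin.append p xs))
        (Term.var (L := lang) (Sum.inr (Fin.natAdd n i))) = xs i :=
    Fin.append_right p xs i
  obtain ⟨c, hc⟩ := this fun x y z hyz =>
    (hvar _ ![u, x, y, z] 2).trans ((hf x y z ((hkeep ![u, x, y, z] 1 2).1 hyz.1)
      ((hkeep ![u, x, y, z] 1 3).1 hyz.2)).trans (hvar _ ![u, x, y, z] 3).symm)
  refine ⟨c, fun y => ?_⟩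
  have h1 := hvar default ![u, c, y] 1
  have h2 := hvar default ![u, c, y] 2
  have h3 (x : M) := hvar default ![u, c, y, x] 0
  have h4 (x : M) := hvar default ![u, c, y, x] 3
  have h5 (x : M) := hkeep ![u, c, y, x] 3 2
  have := hc y
  dsimp only [Function.comp_apply] at this
  erw [h1, h2] at this
  refine this.trans (exists_congr fun x => and_congr ?_ (h5 x))
  erw [h3, h4]
  rfl

/-- A model of ZFC as a universe without atoms. -/
def zfcAtomUniverse : AtomUniverse M where
  mem := Elem
  atom _ := False
  dfn_mem := ⟨memFml (m := 0) (Term.var (Sum.inl (Sum.inr 0)))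
    (Term.var (Sum.inl (Sum.inr 1))), fun v => by simp [Formula.Realize]⟩
  dfn_atom := inferInstance
  not_atom_of_mem _ := not_false
  ext _ _ h := elem_ext hM h
  exists_atoms := by
    -- There are no atoms, so the set of atoms is the empty set, whose existence comes from the
    -- axiom of infinity.
    obtain ⟨c, ⟨e, _, he⟩, _⟩ := exists_elem_inductive hM
    exact ⟨e, not_false, fun z => by simp [he]⟩
  exists_pair x y := by simpa using exists_elem_pair hM x y
  exists_sUnion x := by simpa using exists_elem_sUnion hM x
  exists_powerset x := by simpa using exists_elem_powerset hM x
  exists_image R hR hf u := by simpa using exists_elem_image hM R hR hf u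

/-- The language has no terms for 0 and successor, so its formulas describe them by their elements;
such equivalences match the formulas with the operations. -/
theorem zfc_eq_empty_iff (e : M) : e = (zfcAtomUniverse hM).empty ↔ ∀ z, ¬ Elem z e := by
  refine ((zfcAtomUniverse hM).small_false.eq_cls_iff e).trans ?_
  simp [zfcAtomUniverse]

theorem zfc_eq_succ_iff (a b : M) :
    b = (zfcAtomUniverse hM).succ a ↔ ∀ z, Elem z b ↔ Elem z a ∨ z = a := by
  constructor
  · rintro rfl z
    exact (zfcAtomUniverse hM).mem_succ
  · intro h
    exact elem_ext hM fun z => (h z).trans (zfcAtomUniverse hM).mem_succ.symm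

theorem zfc_isInductive_iff (c : M) : (zfcAtomUniverse hM).IsInductive c ↔
    (∃ e, Elem e c ∧ ∀ z, ¬ Elem z e) ∧
      ∀ a, Elem a c → ∃ b, Elem b c ∧ ∀ z, Elem z b ↔ Elem z a ∨ z = a := by
  simp only [← zfc_eq_empty_iff hM, ← zfc_eq_succ_iff hM]
  simp [AtomUniverse.IsInductive, zfcAtomUniverse]

/-- A model of ZFC as a universe of pure sets. -/
def zfcUniverse : ZFCUniverse M where
  toAtomUniverse := zfcAtomUniverse hM
  not_atom _ := not_false
  foundation := elem_foundation hM
  infinity := (exists_elem_inductive hM).imp fun c hc => (zfc_isInductive_iff hM c).2 hc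
  transversal := exists_elem_transversal hM

theorem realize_natFml {k : ℕ} (v : Fin k → M) (x : M) :
    natFml.Realize v ![x] ↔ (zfcUniverse hM).IsNat x := by
  simp [natFml, inductiveFml]
  refine forall_congr' fun c => ?_
  change _ ↔ ((zfcAtomUniverse hM).IsInductive c → _)
  rw [zfc_isInductive_iff]
  rw [and_imp, forall_exists_index]
  simp only [and_imp]
  rfl

theorem realize_natSubsetFml {k : ℕ} (i : Fin k) (v : Fin k → M) :
    (natSubsetFml i).Realize v ↔ (zfcUniverse hM).NatSubset (v i) := by
  simp [natSubsetFml, Formula.Realize, realize_natFml hM]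
  rfl

theorem realize_containsEmptyFml {k : ℕ} (i : Fin k) (v : Fin k → M) :
    (containsEmptyFml i).Realize v ↔ (zfcUniverse hM).mem (zfcUniverse hM).empty (v i) := by
  simp [containsEmptyFml, Formula.Realize, ← zfc_eq_empty_iff hM]
  rfl

theorem realize_atomFml (x : M) : atomFml.Realize ![x] ↔ (zfcUniverse hM).shift.atom x := by
  simp [atomFml, realize_natSubsetFml hM, realize_containsEmptyFml hM]
  rfl

theorem realize_shiftMemFml (x y : M) :
    shiftMemFml.Realize ![x, y] ↔ (zfcUniverse hM).shift.mem x y := by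
  have h1 := realize_natSubsetFml hM (1 : Fin 2) ![x, y]
  have h2 := realize_containsEmptyFml hM (1 : Fin 2) ![x, y]
  simp only [Formula.Realize] at h1 h2
  simp [shiftMemFml, Formula.Realize, h1, h2, realize_natFml hM, ← zfc_eq_succ_iff hM]
  rfl

end Base

end PureSets

-- Transport of structures, and the conclusion.

namespace AtomSets

/-- A structure transported along a bijection. -/
def Str.map {M N : Type u} (S : Str M) (e : M ≃ N) : Str N where
  mem x y := S.mem (e.symm x) (e.symm y)
  pair x y := e (S.pair (e.symm x) (e.symm y))
  pow x := e (S.pow (e.symm x))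
  sUnion x := e (S.sUnion (e.symm x))
  sep t X := e (S.sep (e.symm t) {x | e x ∈ X})
  empty := e S.empty
  atoms := e S.atoms

theorem Str.Models.map {M N : Type u} {S : Str M} {T : Set (Fm 0)} (h : S.Models T)
    (e : M ≃ N) : (S.map e).Models T := by
  intro σ hσ
  have iso : S.Iso (S.map e) e := by
    constructor <;> simp [Str.map]
  have := (iso.sat σ Fin.elim0).2 (h σ hσ)
  rwa [Subsingleton.elim (e ∘ Fin.elim0) Fin.elim0] at this

end AtomSets

/-- The class model: all sets, with shifted membership, in a model of ZFC. -/
theorem PureSets.exists_class_model (M : Type u) [PureSets.lang.Structure M]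
    (hM : FirstOrder.Language.Theory.Model M PureSets.ZFC) :
    ∃ S : AtomSets.Str {x : M // (⊤ : PureSets.lang.Formula (Fin 1)).Realize ![x]},
      (∀ x y, S.mem x y ↔ PureSets.shiftMemFml.Realize ![(x : M), (y : M)]) ∧
      (∀ x, S.mem x S.atoms ↔ PureSets.atomFml.Realize ![(x : M)]) ∧
      S.Models AtomSets.ZFAC ∧ S.Models AtomSets.EZFAC := by
  let U := (PureSets.zfcUniverse hM).shift
  have hU : U.IsFull := (PureSets.zfcUniverse hM).shift_isFull
  -- Every element satisfies `⊤`, so the class is the whole model and the structure is merely moved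
  -- to a subtype.
  let e : M ≃ {x : M // (⊤ : PureSets.lang.Formula (Fin 1)).Realize ![x]} :=
    (Equiv.subtypeUnivEquiv fun _ => FirstOrder.Language.Formula.realize_top.2 trivial).symm
  refine ⟨U.toStr.map e, fun x y => ?_, fun x => ?_, hU.models_ZFAC.map e, hU.models_EZFAC.map e⟩
  · exact (PureSets.realize_shiftMemFml hM x y).symm
  · exact U.mem_atoms.trans (PureSets.realize_atomFml hM x).symm

theorem PureSets.consistent_of_isSatisfiable_ZFC (h : PureSets.ZFC.IsSatisfiable) :
    AtomSets.Consistent AtomSets.ZFAC ∧ AtomSets.Consistent AtomSets.EZFAC := by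
  obtain ⟨M⟩ := h
  obtain ⟨S, -, -, h1, h2⟩ := PureSets.exists_class_model M M.is_model
  exact ⟨⟨_, S, h1⟩, ⟨_, S, h2⟩⟩

theorem theorem4p2 :
    (PureSets.ZFC.IsSatisfiable → AtomSets.Consistent AtomSets.ZFAC) ∧
    (PureSets.ZFC.IsSatisfiable → AtomSets.Consistent AtomSets.EZFAC) ∧
    ∃ (δ : PureSets.lang.Formula (Fin 1)) (η : PureSets.lang.Formula (Fin 2))
      (α : PureSets.lang.Formula (Fin 1)),
      ∀ (M : Type u) [PureSets.lang.Structure M],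
        FirstOrder.Language.Theory.Model M PureSets.ZFC →
        ∃ S : AtomSets.Str {x : M // δ.Realize ![x]},
          (∀ x y, S.mem x y ↔ η.Realize ![(x : M), (y : M)]) ∧
          (∀ x, S.mem x S.atoms ↔ α.Realize ![(x : M)]) ∧
          S.Models AtomSets.ZFAC ∧ S.Models AtomSets.EZFAC :=
  ⟨fun h => (PureSets.consistent_of_isSatisfiable_ZFC h).1,
    fun h => (PureSets.consistent_of_isSatisfiable_ZFC h).2,
    ⊤, PureSets.shiftMemFml, PureSets.atomFml, fun M _ hM => PureSets.exists_class_model M hM⟩
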